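/- Let $\lambda>0$, $\mathcal T>0$, let $\mathbb T=\mathbb R/\mathcal T\mathbb Z$ carry the normalized Haar measure, and let $G=\mathbb T\times\mathbb R^3$, with dual group $\mathbb Z\times\mathbb R^3$. Let $\phi_\perp$ be the purely periodic part of the time-periodic vorticity fundamental solution, that is, the tempered distribution on $G$ $$\phi_\perp:=\mathscr F_G^{-1}\Big[\frac{1-\delta_{\mathbb Z}(k)}{|\xi|^2-i\lambda\xi_1+i\frac{2\pi}{\mathcal T}k}\Big],$$ where $\delta_{\mathbb Z}(k)=1$ for $k=0$ and $\delta_{\mathbb Z}(k)=0$ otherwise, and $\mathscr F_G^{-1}[g](t,x)=(2\pi)^{-3}\sum_{k\in\mathbb Z}\int_{\mathbb R^3}g(k,\xi)\,e^{i\frac{2\pi}{\mathcal T}kt+ix\cdot\xi}\,\mathrm d\xi$, extended to tempered distributions by duality. Then $\phi_\perp$ and its distributional spatial gradient are given by functions on $G$; on $\mathbb T\times(\mathbb R^3\setminus\{0\})$, $\phi_\perp$ is continuous and continuously differentiable in $x$ with jointly continuous gradient $\nabla\phi_\perp$. There is a constant $C_3=C_3(\lambda,\mathcal T)>0$ such that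 for all $\gamma\in(0,1)$ and $q\in[1,\frac1{1-\gamma})$ there is a constant $C=C(\lambda,\mathcal T,q,\gamma)>0$ such that for all $x\in\mathbb R^3\setminus\{0\}$ $$\|\phi_\perp(\cdot,x)\|_{L^q(\mathbb T)}\le C|x|^{-(1+2\gamma)}e^{-C_3|x|},\qquad \|\nabla\phi_\perp(\cdot,x)\|_{L^q(\mathbb T)}\le C|x|^{-(2+2\gamma)}e^{-C_3|x|}.$$ -/

import Mathlib

open MeasureTheory Set
open scoped ContDiff ENNReal

noncomputable section

namespace TimePeriodic

/-- Three-dimensional Euclidean space. -/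
abbrev E3 : Type := EuclideanSpace ℝ (Fin 3)

/-- The normalized Haar measure on the group `G = 𝕋 × ℝ³`, `𝕋 = ℝ / T ℤ`:
normalized (total mass one) in time, Lebesgue in space. -/
def haarG (T : ℝ) [Fact (0 < T)] : Measure (AddCircle T × E3) :=
  (AddCircle.haarAddCircle (T := T)).prod (volume : Measure E3)

/-- The lift of a function on `𝕋 × ℝ³` to a function on `ℝ × ℝ³` that is `T`-periodic in time. -/
def lift (T : ℝ) {F : Type*} (ψ : AddCircle T → E3 → F) : ℝ × E3 → F :=
  fun z => ψ (z.1 : AddCircle T) z.2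

/-- The Schwartz–Bruhat space of `G = 𝕋 × ℝ³`: smooth functions all of whose derivatives
decay in `x` faster than any power of `|x|`, uniformly in time. -/
def IsSchwartzBruhat (T : ℝ) (ψ : AddCircle T → E3 → ℂ) : Prop :=
  ContDiff ℝ ∞ (lift T ψ) ∧
    ∀ k n : ℕ, ∃ C : ℝ, ∀ z : ℝ × E3, ‖z.2‖ ^ k * ‖iteratedFDeriv ℝ n (lift T ψ) z‖ ≤ C

/-- The Fourier transform on `G`:
`∫_𝕋 ∫_{ℝ³} ψ(t,x) exp(-i (2π/T) k t - i x·ξ) dx dt`. Here `fourier (-k) t` is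
`exp(-i (2π/T) k t)`. -/
def fourierG (T : ℝ) [Fact (0 < T)] (ψ : AddCircle T → E3 → ℂ) (k : ℤ) (ξ : E3) : ℂ :=
  ∫ z, ψ z.1 z.2 * (fourier (-k) z.1 * Complex.exp (-(Complex.I * (inner ℝ z.2 ξ : ℝ))))
    ∂(haarG T)

/-- The inverse Fourier transform on `G`, in the sense of tempered distributions, of a (bounded
measurable) function `m` on the dual group `ℤ × ℝ³`. By duality its value at a test function `ψ`
is `∑ₖ ∫ m(k,ξ) (∫_G ψ(t,x) exp(i (2π/T) k t + i x·ξ) d(t,x)) dξ`, where the measure `dξ` is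
Lebesgue measure divided by `(2π)³` so that Fourier inversion holds on `G`. -/
def invFourierG (T : ℝ) [Fact (0 < T)] (m : ℤ → E3 → ℂ) (ψ : AddCircle T → E3 → ℂ) : ℂ :=
  ∑' k : ℤ, ((2 * Real.pi : ℝ) ^ 3 : ℂ)⁻¹ * ∫ ξ : E3, m k ξ * fourierG T ψ (-k) (-ξ)

/-- The multiplier `(1 - δ_ℤ(k)) / (|ξ|² - i λ ξ₁ + i (2π/T) k)`. -/
def symbolPerp (lam T : ℝ) (k : ℤ) (ξ : E3) : ℂ :=
  (1 - (if k = 0 then 1 else 0)) /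
    ((‖ξ‖ ^ 2 : ℝ) - Complex.I * (lam * ξ 0 : ℝ) + Complex.I * (2 * Real.pi / T * k : ℝ))

/-- The purely periodic part `φ_⊥` of the vorticity fundamental solution, as a distribution
on `G` (a functional on the Schwartz–Bruhat functions). -/
def phiPerpDist (lam T : ℝ) [Fact (0 < T)] : (AddCircle T → E3 → ℂ) → ℂ :=
  invFourierG T (symbolPerp lam T)

/-- The spatial partial derivative `∂_j` of a function on `𝕋 × ℝ³`. -/
def pdx {T : ℝ} (j : Fin 3) (ψ : AddCircle T → E3 → ℂ) (t : AddCircle T) (x : E3) : ℂ :=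
  fderiv ℝ (ψ t) x (EuclideanSpace.single j 1)

/-- The spatial gradient of a function on `𝕋 × ℝ³`. -/
def gradx {T : ℝ} (ψ : AddCircle T → E3 → ℂ) (t : AddCircle T) (x : E3) :
    EuclideanSpace ℂ (Fin 3) :=
  WithLp.toLp 2 fun j => pdx j ψ t x

/-- The distributional spatial derivative `∂_j u`, `⟨∂_j u, ψ⟩ = -⟨u, ∂_j ψ⟩`. -/
def distPdx {T : ℝ} (j : Fin 3) (u : (AddCircle T → E3 → ℂ) → ℂ) :
    (AddCircle T → E3 → ℂ) → ℂ :=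
  fun ψ => -u (pdx j ψ)

/-- The distribution `u` on `G` is the regular distribution given by the function `f`. -/
def IsRegularDist (T : ℝ) [Fact (0 < T)] (u : (AddCircle T → E3 → ℂ) → ℂ)
    (f : AddCircle T → E3 → ℂ) : Prop :=
  ∀ ψ : AddCircle T → E3 → ℂ, IsSchwartzBruhat T ψ →
    Integrable (fun z : AddCircle T × E3 => f z.1 z.2 * ψ z.1 z.2) (haarG T) ∧
      u ψ = ∫ z, f z.1 z.2 * ψ z.1 z.2 ∂(haarG T)

/-- `φ` is the function `φ_⊥`: it represents the distribution `φ_⊥`, it is continuous and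
continuously differentiable in `x` on `𝕋 × (ℝ³ ∖ {0})`, and its pointwise gradient represents
the distributional gradient of `φ_⊥`. Continuity makes `φ(t,x)` and its gradient unique
for all `t` and all `x ≠ 0`. -/
structure IsPhiPerp (lam T : ℝ) [Fact (0 < T)] (φ : AddCircle T → E3 → ℂ) : Prop where
  regular : IsRegularDist T (phiPerpDist lam T) φ
  regular_grad : ∀ j, IsRegularDist T (distPdx j (phiPerpDist lam T)) (pdx j φ)
  continuousOn : ContinuousOn (fun z : AddCircle T × E3 => φ z.1 z.2) {z | z.2 ≠ 0}
  differentiableAt : ∀ t x, x ≠ 0 → DifferentiableAt ℝ (φ t) x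
  continuousOn_grad :
    ContinuousOn (fun z : AddCircle T × E3 => gradx φ z.1 z.2) {z | z.2 ≠ 0}

end TimePeriodic

end

/-! Let `v = (λ/2) e₁`. The `k`-th Fourier coefficient of `φ_⊥` in time is the tilted Yukawa
potential `e^{-⟪v, x⟫ - μₖ|x|} / (4π|x|)` with `μₖ² = |v|² + 2πik/𝒯`, and `Re μₖ - |v|` is at least
a multiple of `√|k|` for `k ≠ 0`. So the coefficients are bounded by `e^{-b√|k||x|} / |x|`, and
their increments in `k` by `e^{-b√|k||x|} / √|k|`, because `|μₖ - μₖ₋₁|` is at most a multiple of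
`1/√|k|`.

Summing the Fourier series in absolute value gives `|φ_⊥| ≲ |x|⁻³ e^{-b|x|/2}`, and summing by parts
gives `|e^{2πit/𝒯} - 1| |φ_⊥| ≲ |x|⁻¹ e^{-b|x|/2}`. Interpolating between the two bounds,
`|φ_⊥| ≲ |x|^{-(1+2γ)} e^{-b|x|/2} |e^{2πit/𝒯} - 1|^{-(1-γ)}`, and the last factor is in `L^q(𝕋)`
because `q(1-γ) < 1`. The gradient gains one more factor `|x|⁻¹`. -/

noncomputable section

namespace TimePeriodic

open Filter Topology Complex
open scoped RealInnerProductSpace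

section Subordination

lemma integral_Ioi_of_hasDerivAt_of_nonneg_of_tendsto {f f' : ℝ → ℝ} {a l m : ℝ}
    (hderiv : ∀ s ∈ Ioi a, HasDerivAt f (f' s) s) (hpos : ∀ s ∈ Ioi a, 0 ≤ f' s)
    (hl : Tendsto f (𝓝[>] a) (𝓝 l)) (hm : Tendsto f atTop (𝓝 m)) :
    ∫ s in Ioi a, f' s = m - l := by
  have heq : ∀ s ∈ Ioi a, Function.update f a l =ᶠ[𝓝 s] f := fun s hs => by
    filter_upwards [lt_mem_nhds hs] with y hy using Function.update_of_ne (ne_of_gt hy) _ _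
  have hcont : ContinuousWithinAt (Function.update f a l) (Ici a) a := by
    rw [continuousWithinAt_update_same, Ici_sdiff_left]
    exact hl
  have hlim : Tendsto (Function.update f a l) atTop (𝓝 m) := by
    refine hm.congr' ?_
    filter_upwards [eventually_gt_atTop a] with y hy using (Function.update_of_ne hy.ne' _ _).symm
  simpa using integral_Ioi_of_hasDerivAt_of_nonneg hcont
    (fun s hs => (hderiv s hs).congr_of_eventuallyEq (heq s hs)) hpos hlim

lemma exists_hasDerivAt_gaussian_tendsto :
    ∃ G : ℝ → ℝ, (∀ y, HasDerivAt G (Real.exp (-y ^ 2)) y) ∧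
      Tendsto G atBot (𝓝 0) ∧ Tendsto G atTop (𝓝 √Real.pi) := by
  have hint : Integrable fun y : ℝ => Real.exp (-y ^ 2) := by
    simpa using integrable_exp_neg_mul_sq one_pos
  have hcont : Continuous fun y : ℝ => Real.exp (-y ^ 2) := by fun_prop
  have hhalf : ∫ y in Ioi (0 : ℝ), Real.exp (-y ^ 2) = √Real.pi / 2 := by
    simpa using integral_gaussian_Ioi 1
  have hhalf' : ∫ y in Iic (0 : ℝ), Real.exp (-y ^ 2) = √Real.pi / 2 := by
    rw [← hhalf, ← neg_zero, ← integral_comp_neg_Ioi, neg_zero]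
    simp only [neg_sq]
  refine ⟨fun y => √Real.pi / 2 + ∫ u in (0 : ℝ)..y, Real.exp (-u ^ 2), fun y => ?_, ?_, ?_⟩
  · exact (hcont.integral_hasStrictDerivAt 0 y).hasDerivAt.const_add _
  · have h := (intervalIntegral_tendsto_integral_Iic 0 hint.integrableOn tendsto_id).const_sub
      (√Real.pi / 2)
    rw [hhalf', sub_self] at h
    exact h.congr fun y => by rw [intervalIntegral.integral_symm 0]; simp
  · have h := (intervalIntegral_tendsto_integral_Ioi 0 hint.integrableOn tendsto_id).const_add
      (√Real.pi / 2)
    rwa [hhalf, add_halves] at h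

variable {r μ : ℝ}

lemma hasDerivAt_mul_sqrt_add_div_sqrt (a b : ℝ) {s : ℝ} (hs : 0 < s) :
    HasDerivAt (fun s => a * √s + b / √s) (a / (2 * √s) - b / (2 * (s * √s))) s := by
  have hsq := Real.hasDerivAt_sqrt hs.ne'
  have hsq0 : √s ≠ 0 := (Real.sqrt_pos.2 hs).ne'
  refine ((hsq.const_mul a).add ((hasDerivAt_const s b).div hsq hsq0)).congr_deriv ?_
  rw [Real.sq_sqrt hs.le]
  field_simp
  ring

lemma tendsto_mul_sqrt_add_div_sqrt_atTop (hμ : 0 < μ) (b : ℝ) :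
    Tendsto (fun s => μ * √s + b / √s) atTop atTop :=
  (Real.tendsto_sqrt_atTop.const_mul_atTop hμ).atTop_add
    (tendsto_const_nhds.div_atTop Real.tendsto_sqrt_atTop)

lemma tendsto_sqrt_nhdsGT_zero : Tendsto Real.sqrt (𝓝[>] 0) (𝓝[>] 0) := by
  refine tendsto_nhdsWithin_iff.2 ⟨?_, ?_⟩
  · simpa using (Real.continuous_sqrt.tendsto 0).mono_left nhdsWithin_le_nhds
  · filter_upwards [self_mem_nhdsWithin] with s hs using Real.sqrt_pos.2 hs

lemma tendsto_mul_sqrt_nhdsGT_zero (μ : ℝ) : Tendsto (fun s => μ * √s) (𝓝[>] 0) (𝓝 0) := by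
  simpa using (tendsto_sqrt_nhdsGT_zero.mono_right nhdsWithin_le_nhds).const_mul μ

/- The primitive is `e^{-μr} G(μ√s - r/(2√s)) - e^{μr} G(μ√s + r/(2√s))` up to a factor `r / 2`,
with `G' = e^{-y²}`: both products of exponentials are equal to `exp (-r² / (4s) - μ² s)`. -/
lemma integral_exp_neg_div_sub_mul_div_mul_sqrt (hr : 0 < r) (hμ : 0 < μ) :
    ∫ s in Ioi (0 : ℝ), Real.exp (-r ^ 2 / (4 * s) - μ ^ 2 * s) / (s * √s) =
      2 * √Real.pi * Real.exp (-(μ * r)) / r := by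
  obtain ⟨G, hG, hbot, htop⟩ := exists_hasDerivAt_gaussian_tendsto
  have hG_mul (b : ℝ) {s : ℝ} (hs : 0 < s) : HasDerivAt
      (fun s => Real.exp (2 * μ * b) * G (μ * √s + b / √s))
      (Real.exp (-b ^ 2 / s - μ ^ 2 * s) * (μ / (2 * √s) - b / (2 * (s * √s)))) s := by
    refine (((hG _).comp s (hasDerivAt_mul_sqrt_add_div_sqrt μ b hs)).const_mul _).congr_deriv ?_
    rw [← mul_assoc, ← Real.exp_add]
    have hsq0 : √s ≠ 0 := (Real.sqrt_pos.2 hs).ne'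
    have hsq : √s ^ 2 = s := Real.sq_sqrt hs.le
    congr 2
    rw [← hsq, Real.sqrt_sq (Real.sqrt_nonneg s)]
    field_simp
    ring
  have hderiv : ∀ s ∈ Ioi (0 : ℝ), HasDerivAt
      (fun s => Real.exp (2 * μ * (-(r / 2))) * G (μ * √s + -(r / 2) / √s) -
        Real.exp (2 * μ * (r / 2)) * G (μ * √s + r / 2 / √s))
      (r / 2 * (Real.exp (-r ^ 2 / (4 * s) - μ ^ 2 * s) / (s * √s))) s := by
    intro s hs
    have hs : 0 < s := hs
    refine ((hG_mul (-(r / 2)) hs).sub (hG_mul (r / 2) hs)).congr_deriv ?_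
    rw [neg_sq, show -(r / 2) ^ 2 / s = -r ^ 2 / (4 * s) by field_simp; ring]
    ring
  have hinv : Tendsto (fun s => r / 2 / √s) (𝓝[>] 0) atTop := by
    simpa only [div_eq_mul_inv, Function.comp_def] using
      (tendsto_inv_nhdsGT_zero.comp tendsto_sqrt_nhdsGT_zero).const_mul_atTop (half_pos hr)
  have hlow : Tendsto (fun s => μ * √s + -(r / 2) / √s) (𝓝[>] 0) atBot := by
    simpa only [neg_div, Function.comp_def] using
      (tendsto_mul_sqrt_nhdsGT_zero μ).add_atBot (tendsto_neg_atTop_atBot.comp hinv)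
  have hkey := integral_Ioi_of_hasDerivAt_of_nonneg_of_tendsto hderiv
    (fun s hs => by have hs : 0 < s := hs; positivity)
    (((hbot.comp hlow).const_mul _).sub
      ((htop.comp ((tendsto_mul_sqrt_nhdsGT_zero μ).add_atTop hinv)).const_mul _))
    (((htop.comp (tendsto_mul_sqrt_add_div_sqrt_atTop hμ _)).const_mul _).sub
      ((htop.comp (tendsto_mul_sqrt_add_div_sqrt_atTop hμ _)).const_mul _))
  rw [integral_const_mul] at hkey
  rw [show -(μ * r) = 2 * μ * (-(r / 2)) by ring, eq_div_iff hr.ne']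
  linarith

end Subordination

section HeatKernel

variable {ι : Type*} [Fintype ι]

/-- The heat kernel of `EuclideanSpace ℝ ι` at time `s`. -/
def heatKernel (s : ℝ) (x : EuclideanSpace ℝ ι) : ℝ :=
  ((4 * Real.pi * s) ^ (Fintype.card ι / 2 : ℝ))⁻¹ * Real.exp (-‖x‖ ^ 2 / (4 * s))

lemma heatKernel_nonneg {s : ℝ} (hs : 0 ≤ s) (x : EuclideanSpace ℝ ι) : 0 ≤ heatKernel s x := by
  unfold heatKernel
  positivity

@[fun_prop]
lemma measurable_heatKernel :
    Measurable fun z : ℝ × EuclideanSpace ℝ ι => heatKernel z.1 z.2 := by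
  unfold heatKernel
  fun_prop

lemma integrable_heatKernel_mul_exp {s : ℝ} (hs : 0 < s) (v : EuclideanSpace ℝ ι) :
    Integrable fun x : EuclideanSpace ℝ ι => heatKernel s x * Real.exp (-⟪v, x⟫) := by
  have hb : 0 < ((4 * s : ℝ)⁻¹ : ℂ).re := by rw [← ofReal_inv, ofReal_re]; positivity
  have h := (GaussianFourier.integrable_cexp_neg_mul_sq_norm_add hb (-1) v).re.const_mul
    ((4 * Real.pi * s) ^ (Fintype.card ι / 2 : ℝ))⁻¹
  refine h.congr (.of_forall fun x => ?_)
  simp only [heatKernel, mul_assoc, ← Real.exp_add]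
  congr 1
  rw [show -((4 * s : ℝ) : ℂ)⁻¹ * ‖x‖ ^ 2 + -1 * ⟪v, x⟫ =
    ((-‖x‖ ^ 2 / (4 * s) + -⟪v, x⟫ : ℝ) : ℂ) by push_cast; ring, ← ofReal_exp]
  exact ofReal_re _

lemma integral_heatKernel_mul_cexp {s : ℝ} (hs : 0 < s) (v ξ : EuclideanSpace ℝ ι) :
    ∫ x : EuclideanSpace ℝ ι, heatKernel s x * cexp (-⟪v, x⟫ - I * ⟪x, ξ⟫) =
      cexp (s * (‖v‖ ^ 2 - ‖ξ‖ ^ 2 + 2 * I * ⟪v, ξ⟫)) := by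
  have hb : 0 < (((4 * s)⁻¹ : ℝ) : ℂ).re := by rw [ofReal_re]; positivity
  have hs0 : (s : ℂ) ≠ 0 := ofReal_ne_zero.2 hs.ne'
  have hpos : 0 < (4 * Real.pi * s) ^ (Fintype.card ι / 2 : ℝ) := by positivity
  set ζ : ι → ℂ := fun i => -(v i) - I * ξ i
  have hexponent : ∑ i, ζ i ^ 2 = ‖v‖ ^ 2 - ‖ξ‖ ^ 2 + 2 * I * ⟪v, ξ⟫ := by
    simp only [← real_inner_self_eq_norm_sq, ← ofReal_pow, PiLp.inner_apply, RCLike.inner_apply,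
      conj_trivial, ofReal_sum, ofReal_mul, Finset.mul_sum, ← Finset.sum_sub_distrib,
      ← Finset.sum_add_distrib, ζ]
    refine Finset.sum_congr rfl fun i _ => ?_
    linear_combination (ξ i : ℂ) ^ 2 * I_sq
  have hconst : ((Real.pi : ℂ) / (((4 * s)⁻¹ : ℝ) : ℂ)) ^ ((Fintype.card ι : ℂ) / 2) =
      ((4 * Real.pi * s) ^ (Fintype.card ι / 2 : ℝ) : ℝ) := by
    rw [ofReal_cpow (by positivity)]
    congr 1 <;> push_cast <;> field_simp
  have hgauss := GaussianFourier.integral_cexp_neg_mul_sum_add hb ζ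
  rw [hconst, hexponent] at hgauss
  rw [← (PiLp.volume_preserving_toLp ι).integral_comp
    (MeasurableEquiv.toLp 2 _).measurableEmbedding]
  calc _ = ∫ x : ι → ℝ, ((4 * Real.pi * s) ^ (Fintype.card ι / 2 : ℝ) : ℝ)⁻¹ *
        cexp (-(((4 * s)⁻¹ : ℝ) : ℂ) * ∑ i, (x i : ℂ) ^ 2 + ∑ i, ζ i * x i) := by
        congr with x
        simp only [heatKernel, ofReal_mul, ofReal_inv, ofReal_exp, mul_assoc, ← Complex.exp_add]
        congr 2
        simp only [EuclideanSpace.norm_sq_eq, Real.norm_eq_abs, sq_abs, PiLp.inner_apply,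
          RCLike.inner_apply, conj_trivial, ζ, sub_mul, Finset.sum_sub_distrib, neg_mul,
          Finset.sum_neg_distrib, mul_assoc, ← Finset.mul_sum]
        push_cast
        simp only [mul_comm]
        ring
    _ = _ := by
        rw [integral_const_mul, hgauss, ofReal_inv,
          inv_mul_cancel_left₀ (ofReal_ne_zero.2 hpos.ne')]
        congr 1
        push_cast
        field_simp

lemma integral_heatKernel_mul_exp {s : ℝ} (hs : 0 < s) (v : EuclideanSpace ℝ ι) :
    ∫ x : EuclideanSpace ℝ ι, heatKernel s x * Real.exp (-⟪v, x⟫) = Real.exp (s * ‖v‖ ^ 2) := by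
  refine ofReal_injective ?_
  rw [← integral_complex_ofReal]
  simpa using integral_heatKernel_mul_cexp hs v 0

end HeatKernel

section Yukawa

variable {V : Type*} [NormedAddCommGroup V] [InnerProductSpace ℝ V]

/-- The Yukawa potential `e^{-μρ} / (4πρ)` of complex mass `μ`, tilted by the exponential weight
`e^{-⟪v, x⟫}`. The radius `ρ` is kept separate from `x`, so that the singular choice `ρ = ‖x‖` and
its regularization `ρ = √(‖x‖² + ε²)` can be treated together. -/
def yukawa (μ : ℂ) (v : V) (ρ : ℝ) (x : V) : ℂ :=
  ((4 * Real.pi * ρ : ℝ) : ℂ)⁻¹ * cexp (-(μ * ρ) - ⟪v, x⟫)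

lemma norm_yukawa_le (μ : ℂ) (v : V) {ρ : ℝ} {x : V} (hx : ‖x‖ ≤ ρ) :
    ‖yukawa μ v ρ x‖ ≤ ρ⁻¹ * Real.exp (-((μ.re - ‖v‖) * ρ)) := by
  have hρ : 0 ≤ ρ := (norm_nonneg x).trans hx
  have hvx : -⟪v, x⟫ ≤ ‖v‖ * ρ :=
    (neg_le_abs _).trans ((abs_real_inner_le_norm v x).trans (by gcongr))
  have hpi : 1 ≤ 4 * Real.pi := by linarith [Real.pi_gt_three]
  rw [yukawa, norm_mul, norm_inv, norm_real, Real.norm_of_nonneg (by positivity), mul_inv,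
    Complex.norm_exp, sub_re, neg_re, re_mul_ofReal, ofReal_re]
  gcongr
  · exact mul_le_of_le_one_left (by positivity) (inv_le_one_of_one_le₀ hpi)
  · linarith

lemma hasDerivAt_yukawa_mass (v : V) (μ : ℂ) (x : V) :
    HasDerivAt (fun μ => yukawa μ v ‖x‖ x) (-(‖x‖ * yukawa μ v ‖x‖ x)) μ := by
  have hexponent : HasDerivAt (fun μ : ℂ => -(μ * ‖x‖) - ⟪v, x⟫) (-‖x‖) μ := by
    simpa using (((hasDerivAt_id μ).mul_const (‖x‖ : ℂ)).fun_neg.sub_const (⟪v, x⟫ : ℂ))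
  refine (hexponent.cexp.const_mul ((4 * Real.pi * ‖x‖ : ℝ) : ℂ)⁻¹).congr_deriv ?_
  rw [yukawa]
  ring

end Yukawa

lemma integrable_norm_rpow_mul_exp {V : Type*} [NormedAddCommGroup V] [NormedSpace ℝ V]
    [FiniteDimensional ℝ V] [MeasurableSpace V] [BorelSpace V] [Nontrivial V] (m : Measure V)
    [m.IsAddHaarMeasure] {s c : ℝ} (hs : s < Module.finrank ℝ V) (hc : 0 < c) :
    Integrable (fun x : V => ‖x‖ ^ (-s) * Real.exp (-(c * ‖x‖))) m := by
  rw [integrable_fun_norm_addHaar m (f := fun y : ℝ => y ^ (-s) * Real.exp (-(c * y)))]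
  have hd : 1 ≤ Module.finrank ℝ V := Module.finrank_pos
  refine (integrableOn_rpow_mul_exp_neg_mul_rpow (p := 1) (s := (Module.finrank ℝ V - 1 : ℕ) - s)
    (by push_cast [hd]; linarith) one_pos hc).congr_fun (fun y hy => ?_) measurableSet_Ioi
  have hy : (0 : ℝ) < y := hy
  simp only [Real.rpow_one, smul_eq_mul]
  rw [← mul_assoc, ← Real.rpow_natCast, ← Real.rpow_add hy, neg_mul, sub_eq_add_neg]

section Fourier

variable {v : E3} {μ : ℂ}

@[fun_prop]
lemma measurable_yukawa (μ : ℂ) (v : E3) : Measurable fun x => yukawa μ v ‖x‖ x := by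
  unfold yukawa
  fun_prop

lemma integrable_yukawa (hμ : ‖v‖ < μ.re) : Integrable fun x : E3 => yukawa μ v ‖x‖ x := by
  refine (integrable_norm_rpow_mul_exp volume (s := 1) (by simp) (sub_pos.2 hμ)).mono'
    (measurable_yukawa μ v).aestronglyMeasurable (.of_forall fun x => ?_)
  rw [Real.rpow_neg_one]
  exact norm_yukawa_le μ v le_rfl

lemma norm_cexp_neg_I_mul_ofReal (s : ℝ) : ‖cexp (-(I * s))‖ = 1 := by
  simpa using norm_exp_I_mul_ofReal (-s)

lemma integral_exp_mul_heatKernel {μ : ℝ} (hμ : 0 < μ) {x : E3} (hx : x ≠ 0) :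
    ∫ s in Ioi (0 : ℝ), Real.exp (-(μ ^ 2 * s)) * heatKernel s x =
      (4 * Real.pi * ‖x‖)⁻¹ * Real.exp (-(μ * ‖x‖)) := by
  have hx' := norm_pos_iff.2 hx
  have heq : ∀ s ∈ Ioi (0 : ℝ), Real.exp (-(μ ^ 2 * s)) * heatKernel s x =
      (8 * (Real.pi * √Real.pi))⁻¹ *
        (Real.exp (-‖x‖ ^ 2 / (4 * s) - μ ^ 2 * s) / (s * √s)) := by
    intro s hs
    have hs : 0 < s := hs
    have hpow : (4 * Real.pi * s) ^ (Fintype.card (Fin 3) / 2 : ℝ) =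
        8 * (Real.pi * √Real.pi) * (s * √s) := by
      rw [Fintype.card_fin, show ((3 : ℕ) / 2 : ℝ) = 1 + 1 / 2 by norm_num,
        Real.rpow_add (by positivity), Real.rpow_one, ← Real.sqrt_eq_rpow,
        Real.sqrt_mul (by positivity), Real.sqrt_mul (by norm_num),
        show √(4 : ℝ) = 2 from Real.sqrt_eq_iff_mul_self_eq_of_pos two_pos |>.2 (by norm_num)]
      ring
    rw [heatKernel, hpow, sub_eq_add_neg, Real.exp_add]
    field_simp
  rw [setIntegral_congr_fun measurableSet_Ioi heq, integral_const_mul,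
    integral_exp_neg_div_sub_mul_div_mul_sqrt hx' hμ]
  field_simp
  ring

lemma integrable_exp_mul_heatKernel_mul_cexp {μ : ℝ} (hμ : ‖v‖ < μ) (ξ : E3) :
    Integrable (fun z : ℝ × E3 =>
      Real.exp (-(μ ^ 2 * z.1)) * heatKernel z.1 z.2 * cexp (-⟪v, z.2⟫ - I * ⟪z.2, ξ⟫))
      ((volume.restrict (Ioi 0)).prod volume) := by
  have hnorm : ∀ s ∈ Ioi (0 : ℝ), ∀ x : E3,
      ‖Real.exp (-(μ ^ 2 * s)) * heatKernel s x * cexp (-⟪v, x⟫ - I * ⟪x, ξ⟫)‖ =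
        Real.exp (-(μ ^ 2 * s)) * (heatKernel s x * Real.exp (-⟪v, x⟫)) := by
    intro s hs x
    rw [sub_eq_add_neg, Complex.exp_add, ← ofReal_mul, ← ofReal_neg, ← ofReal_exp, norm_mul,
      norm_mul, norm_cexp_neg_I_mul_ofReal, mul_one, norm_real, norm_real,
      Real.norm_of_nonneg (mul_nonneg (Real.exp_nonneg _) (heatKernel_nonneg (le_of_lt hs) x)),
      Real.norm_of_nonneg (Real.exp_nonneg _), mul_assoc]
  have hdecay : 0 < μ ^ 2 - ‖v‖ ^ 2 := sub_pos.2 (by gcongr)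
  refine (integrable_prod_iff (by fun_prop)).2 ⟨?_, ?_⟩
  · filter_upwards [ae_restrict_mem measurableSet_Ioi] with s hs
    refine ((integrable_heatKernel_mul_exp hs v).const_mul (Real.exp (-(μ ^ 2 * s)))).mono'
      (Measurable.aestronglyMeasurable (by fun_prop)) (.of_forall fun x => (hnorm s hs x).le)
  · refine (integrableOn_exp_mul_Ioi (neg_neg_of_pos hdecay) 0).congr ?_
    filter_upwards [ae_restrict_mem measurableSet_Ioi] with s hs
    simp_rw [hnorm s hs]
    rw [integral_const_mul, integral_heatKernel_mul_exp hs, ← Real.exp_add]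
    ring_nf

lemma integral_yukawa_mul_cexp_ofReal {μ : ℝ} (hμ : ‖v‖ < μ) (ξ : E3) :
    (∫ x : E3, yukawa μ v ‖x‖ x * cexp (-(I * ⟪x, ξ⟫))) *
      ((μ : ℂ) ^ 2 - ‖v‖ ^ 2 + ‖ξ‖ ^ 2 - 2 * I * ⟪v, ξ⟫) = 1 := by
  have hμ0 : 0 < μ := (norm_nonneg v).trans_lt hμ
  set p : ℂ := (μ : ℂ) ^ 2 - ‖v‖ ^ 2 + ‖ξ‖ ^ 2 - 2 * I * ⟪v, ξ⟫ with hp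
  have hp_re : 0 < p.re := by
    have hre : p.re = μ ^ 2 - ‖v‖ ^ 2 + ‖ξ‖ ^ 2 := by simp [hp, ← ofReal_pow]
    rw [hre]
    have : ‖v‖ ^ 2 < μ ^ 2 := by gcongr
    positivity [sub_pos.2 this]
  have hspace : ∀ s ∈ Ioi (0 : ℝ), ∫ x : E3, Real.exp (-(μ ^ 2 * s)) * heatKernel s x *
      cexp (-⟪v, x⟫ - I * ⟪x, ξ⟫) = cexp (-p * s) := by
    intro s hs
    simp_rw [mul_assoc]
    rw [integral_const_mul, integral_heatKernel_mul_cexp hs, ofReal_exp, ← Complex.exp_add]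
    congr 1
    push_cast
    ring
  have htime : ∀ᵐ x : E3, ∫ s in Ioi (0 : ℝ), Real.exp (-(μ ^ 2 * s)) * heatKernel s x *
      cexp (-⟪v, x⟫ - I * ⟪x, ξ⟫) = yukawa μ v ‖x‖ x * cexp (-(I * ⟪x, ξ⟫)) := by
    filter_upwards [Measure.ae_ne volume 0] with x hx
    simp_rw [← ofReal_mul]
    rw [integral_mul_const, integral_complex_ofReal, integral_exp_mul_heatKernel hμ0 hx, yukawa,
      mul_assoc _ (cexp _), ← Complex.exp_add, ofReal_mul, mul_assoc, ofReal_exp,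
      ← Complex.exp_add, ofReal_inv]
    congr 2
    push_cast
    ring
  have hswap := integral_integral_swap (f := fun s x => Real.exp (-(μ ^ 2 * s)) *
    heatKernel s x * cexp (-⟪v, x⟫ - I * ⟪x, ξ⟫)) (integrable_exp_mul_heatKernel_mul_cexp hμ ξ)
  rw [integral_congr_ae htime, setIntegral_congr_fun measurableSet_Ioi hspace,
    integral_exp_mul_complex_Ioi (by simpa using hp_re)] at hswap
  rw [← hswap]
  have hp0 : p ≠ 0 := fun h => by simp [h] at hp_re
  simp [hp0]

lemma differentiableOn_integral_yukawa_mul_cexp (v ξ : E3) :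
    DifferentiableOn ℂ (fun μ => ∫ x : E3, yukawa μ v ‖x‖ x * cexp (-(I * ⟪x, ξ⟫)))
      {μ | ‖v‖ < μ.re} := by
  intro μ₀ hμ₀
  obtain ⟨b, hvb, hbμ⟩ := exists_between (show ‖v‖ < μ₀.re from hμ₀)
  have hopen : IsOpen {μ : ℂ | b < μ.re} := isOpen_lt continuous_const continuous_re
  have hunit (x : E3) := norm_cexp_neg_I_mul_ofReal ⟪x, ξ⟫
  have hderiv := hasDerivAt_integral_of_dominated_loc_of_deriv_le (μ := (volume : Measure E3))
    (F := fun μ (x : E3) => yukawa μ v ‖x‖ x * cexp (-(I * ⟪x, ξ⟫)))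
    (F' := fun μ (x : E3) => -(‖x‖ * yukawa μ v ‖x‖ x) * cexp (-(I * ⟪x, ξ⟫)))
    (bound := fun x : E3 => ‖x‖ ^ (-(0 : ℝ)) * Real.exp (-((b - ‖v‖) * ‖x‖)))
    (hopen.mem_nhds hbμ)
    (.of_forall fun μ => Measurable.aestronglyMeasurable (by fun_prop))
    ((integrable_yukawa hμ₀).mono (Measurable.aestronglyMeasurable (by fun_prop))
      (.of_forall fun x => by rw [norm_mul, hunit, mul_one]))
    (Measurable.aestronglyMeasurable (by fun_prop))
    (.of_forall fun x μ hμ => ?_)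
    (integrable_norm_rpow_mul_exp volume (by simp) (sub_pos.2 hvb))
    (.of_forall fun x μ _ => (hasDerivAt_yukawa_mass v μ x).mul_const _)
  · exact hderiv.2.differentiableAt.differentiableWithinAt
  · have hμ : b < μ.re := hμ
    rw [norm_mul, hunit, mul_one, norm_neg, norm_mul, norm_real, norm_norm, neg_zero,
      Real.rpow_zero, one_mul]
    calc ‖x‖ * ‖yukawa μ v ‖x‖ x‖
        ≤ ‖x‖ * (‖x‖⁻¹ * Real.exp (-((μ.re - ‖v‖) * ‖x‖))) := by
          gcongr
          exact norm_yukawa_le μ v le_rfl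
      _ ≤ Real.exp (-((μ.re - ‖v‖) * ‖x‖)) := by
          rw [← mul_assoc]
          exact mul_le_of_le_one_left (Real.exp_nonneg _) (mul_inv_le_one)
      _ ≤ _ := by gcongr

theorem integral_yukawa_mul_cexp (hμ : ‖v‖ < μ.re) (ξ : E3) :
    (∫ x : E3, yukawa μ v ‖x‖ x * cexp (-(I * ⟪x, ξ⟫))) *
      (μ ^ 2 - ‖v‖ ^ 2 + ‖ξ‖ ^ 2 - 2 * I * ⟪v, ξ⟫) = 1 := by
  have hopen : IsOpen {μ : ℂ | ‖v‖ < μ.re} := isOpen_lt continuous_const continuous_re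
  have hanalytic : AnalyticOnNhd ℂ (fun μ =>
      (∫ x : E3, yukawa μ v ‖x‖ x * cexp (-(I * ⟪x, ξ⟫))) *
        (μ ^ 2 - ‖v‖ ^ 2 + ‖ξ‖ ^ 2 - 2 * I * ⟪v, ξ⟫)) {μ | ‖v‖ < μ.re} :=
    ((differentiableOn_integral_yukawa_mul_cexp v ξ).mul (by fun_prop)).analyticOnNhd hopen
  have hreal : Tendsto ((↑) : ℝ → ℂ) (𝓝[>] (‖v‖ + 1)) (𝓝[≠] ((‖v‖ + 1 : ℝ) : ℂ)) :=
    tendsto_nhdsWithin_iff.2 ⟨(continuous_ofReal.tendsto _).mono_left nhdsWithin_le_nhds, by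
      filter_upwards [self_mem_nhdsWithin] with y hy using ofReal_injective.ne (ne_of_gt hy)⟩
  refine hanalytic.eqOn_of_preconnected_of_frequently_eq analyticOnNhd_const
    (convex_halfSpace_re_gt ‖v‖).isPreconnected (z₀ := ((‖v‖ + 1 : ℝ) : ℂ)) (by simp)
    (hreal.frequently (Eventually.frequently ?_)) hμ
  filter_upwards [self_mem_nhdsWithin] with y hy
  exact integral_yukawa_mul_cexp_ofReal ((lt_add_one _).trans hy) ξ

end Fourier

section YukawaDeriv

variable {V : Type*} [NormedAddCommGroup V] [InnerProductSpace ℝ V]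

/-- The real linear form `⟪w, ·⟫` with complex values. -/
def innerForm (w : V) : V →L[ℝ] ℂ := ofRealCLM ∘L innerSL ℝ w

lemma innerForm_apply (w y : V) : innerForm w y = (⟪w, y⟫ : ℂ) := rfl

lemma norm_innerForm_le (w : V) : ‖innerForm w‖ ≤ ‖w‖ := by
  refine ContinuousLinearMap.opNorm_le_bound _ (norm_nonneg w) fun y => ?_
  rw [innerForm_apply, norm_real]
  exact norm_inner_le_norm w y

lemma continuous_innerForm : Continuous (innerForm : V → V →L[ℝ] ℂ) :=
  ((ContinuousLinearMap.compL ℝ V ℝ ℂ ofRealCLM).comp (innerSL ℝ)).continuous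

/-- The derivative of `x ↦ yukawa μ v (ρ x) x` for a radius with gradient `∇ρ = x / ρ`. -/
def yukawaDeriv (μ : ℂ) (v : V) (ρ : ℝ) (x : V) : V →L[ℝ] ℂ :=
  -yukawa μ v ρ x • (innerForm v + ((ρ : ℂ)⁻¹ ^ 2 + μ * (ρ : ℂ)⁻¹) • innerForm x)

lemma hasFDerivAt_yukawa (μ : ℂ) (v : V) {ρ : V → ℝ} {x : V}
    (hρ : HasFDerivAt ρ ((ρ x)⁻¹ • innerSL ℝ x) x) (hx : ρ x ≠ 0) :
    HasFDerivAt (fun y => yukawa μ v (ρ y) y) (yukawaDeriv μ v (ρ x) x) x := by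
  have hρc : HasFDerivAt (fun y => (ρ y : ℂ)) (((ρ x : ℂ)⁻¹) • innerForm x) x := by
    refine (ofRealCLM.hasFDerivAt.comp x hρ).congr_fderiv ?_
    ext y
    simp [innerForm_apply]
  have hv : HasFDerivAt (fun y => (⟪v, y⟫ : ℂ)) (innerForm v) x := (innerForm v).hasFDerivAt
  have hx0 : (ρ x : ℂ) ≠ 0 := ofReal_ne_zero.2 hx
  have hinv : HasFDerivAt (fun y => ((4 * Real.pi * ρ y : ℝ) : ℂ)⁻¹)
      (-((4 * Real.pi * ρ x : ℝ) : ℂ)⁻¹ • (ρ x : ℂ)⁻¹ ^ 2 • innerForm x) x := by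
    simp only [ofReal_mul, mul_inv, ofReal_ofNat]
    refine (((hasDerivAt_inv hx0).comp_hasFDerivAt x hρc).const_mul _).congr_fderiv ?_
    simp only [smul_smul]
    congr 1
    field_simp
  refine (hinv.mul ((hρc.const_mul μ).neg.sub hv).cexp).congr_fderiv ?_
  ext y
  simp only [yukawaDeriv, yukawa, add_apply, smul_apply, sub_apply, neg_apply, smul_eq_mul,
    Pi.sub_apply, Pi.neg_apply]
  ring

lemma hasFDerivAt_norm {x : V} (hx : x ≠ 0) :
    HasFDerivAt (fun y : V => ‖y‖) (‖x‖⁻¹ • innerSL ℝ x) x := by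
  have h := (hasStrictFDerivAt_norm_sq x).hasFDerivAt.sqrt (by simpa using hx)
  simp only [Real.sqrt_sq (norm_nonneg _)] at h
  refine h.congr_fderiv ?_
  rw [← Nat.cast_smul_eq_nsmul ℝ, smul_smul]
  congr 1
  field_simp
  norm_num

lemma hasFDerivAt_yukawa_norm (μ : ℂ) (v : V) {x : V} (hx : x ≠ 0) :
    HasFDerivAt (fun y => yukawa μ v ‖y‖ y) (yukawaDeriv μ v ‖x‖ x) x :=
  hasFDerivAt_yukawa μ v (hasFDerivAt_norm hx) (norm_ne_zero_iff.2 hx)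

lemma norm_yukawaDeriv_factor_le (μ : ℂ) (v : V) {ρ : ℝ} {x : V} (hx : ‖x‖ ≤ ρ) :
    ‖innerForm v + ((ρ : ℂ)⁻¹ ^ 2 + μ * (ρ : ℂ)⁻¹) • innerForm x‖ ≤ ‖v‖ + ‖μ‖ + ρ⁻¹ := by
  have hρ : 0 ≤ ρ := (norm_nonneg x).trans hx
  have hcoef : ‖(ρ : ℂ)⁻¹ ^ 2 + μ * (ρ : ℂ)⁻¹‖ ≤ (ρ⁻¹ + ‖μ‖) * ρ⁻¹ := by
    refine (norm_add_le _ _).trans_eq ?_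
    rw [norm_pow, norm_mul, norm_inv, norm_real, Real.norm_of_nonneg hρ]
    ring
  calc _ ≤ ‖v‖ + (ρ⁻¹ + ‖μ‖) * ρ⁻¹ * ρ := by
        refine (norm_add_le _ _).trans (add_le_add (norm_innerForm_le v) ?_)
        rw [norm_smul]
        gcongr
        exact (norm_innerForm_le x).trans hx
    _ ≤ ‖v‖ + (ρ⁻¹ + ‖μ‖) := by
        rw [mul_assoc]
        gcongr
        exact mul_le_of_le_one_right (by positivity) inv_mul_le_one
    _ = _ := by ring

lemma norm_yukawaDeriv_le (μ : ℂ) (v : V) {ρ : ℝ} {x : V} (hx : ‖x‖ ≤ ρ) :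
    ‖yukawaDeriv μ v ρ x‖ ≤
      ρ⁻¹ * Real.exp (-((μ.re - ‖v‖) * ρ)) * (‖v‖ + ‖μ‖ + ρ⁻¹) := by
  have hρ : 0 ≤ ρ := (norm_nonneg x).trans hx
  rw [yukawaDeriv, norm_smul, norm_neg]
  gcongr
  exacts [norm_yukawa_le μ v hx, norm_yukawaDeriv_factor_le μ v hx]

lemma hasDerivAt_yukawaDeriv_mass (v : V) (μ : ℂ) (x : V) :
    HasDerivAt (fun μ => yukawaDeriv μ v ‖x‖ x)
      (-(‖x‖ : ℂ) • yukawaDeriv μ v ‖x‖ x - (yukawa μ v ‖x‖ x * (‖x‖ : ℂ)⁻¹) • innerForm x) μ := by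
  have hfactor : HasDerivAt
      (fun μ : ℂ => innerForm v + ((‖x‖ : ℂ)⁻¹ ^ 2 + μ * (‖x‖ : ℂ)⁻¹) • innerForm x)
      ((‖x‖ : ℂ)⁻¹ • innerForm x) μ := by
    simpa only [id, one_mul] using (((((hasDerivAt_id μ).mul_const (‖x‖ : ℂ)⁻¹).const_add
      ((‖x‖ : ℂ)⁻¹ ^ 2)).smul_const (innerForm x)).const_add (innerForm v))
  refine ((hasDerivAt_yukawa_mass v μ x).fun_neg.smul hfactor).congr_deriv ?_
  simp only [yukawaDeriv]
  module

lemma norm_yukawaDeriv_mass_le (v : V) (μ : ℂ) {x : V} (hx : x ≠ 0) :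
    ‖-(‖x‖ : ℂ) • yukawaDeriv μ v ‖x‖ x - (yukawa μ v ‖x‖ x * (‖x‖ : ℂ)⁻¹) • innerForm x‖ ≤
      Real.exp (-((μ.re - ‖v‖) * ‖x‖)) * (‖v‖ + ‖μ‖ + 2 * ‖x‖⁻¹) := by
  have hr : 0 < ‖x‖ := norm_pos_iff.2 hx
  calc _ ≤ ‖x‖ * ‖yukawaDeriv μ v ‖x‖ x‖ + ‖yukawa μ v ‖x‖ x‖ * ‖x‖⁻¹ * ‖x‖ := by
        refine (norm_sub_le _ _).trans ?_
        rw [norm_smul, norm_smul, norm_neg, norm_mul, norm_inv, norm_real, norm_norm]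
        gcongr
        exact norm_innerForm_le x
    _ ≤ ‖x‖ * (‖x‖⁻¹ * Real.exp (-((μ.re - ‖v‖) * ‖x‖)) * (‖v‖ + ‖μ‖ + ‖x‖⁻¹)) +
        ‖x‖⁻¹ * Real.exp (-((μ.re - ‖v‖) * ‖x‖)) * ‖x‖⁻¹ * ‖x‖ := by
        gcongr
        exacts [norm_yukawaDeriv_le μ v le_rfl, norm_yukawa_le μ v le_rfl]
    _ = _ := by
        field_simp
        ring

end YukawaDeriv

section Mass

/-- The square root of `a² + i s` with nonnegative real part. -/
def mass (a s : ℝ) : ℂ := ((a ^ 2 : ℝ) + I * s) ^ (2⁻¹ : ℂ)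

lemma mass_sq (a s : ℝ) : mass a s ^ 2 = (a : ℂ) ^ 2 + I * s := by
  rw [mass, show (2⁻¹ : ℂ) = ((2 : ℕ) : ℂ)⁻¹ by norm_num, cpow_nat_inv_pow _ two_ne_zero]
  push_cast
  rfl

lemma abs_le_mass_re (a s : ℝ) : |a| ≤ (mass a s).re := by
  have hre : (((a ^ 2 : ℝ) : ℂ) + I * s).re = a ^ 2 := by simp [-ofReal_pow]
  rw [mass, cpow_inv_two_re, hre]
  refine Real.abs_le_sqrt ?_
  have := re_le_norm (((a ^ 2 : ℝ) : ℂ) + I * s)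
  linarith

lemma norm_mass_sq_le (a s : ℝ) : ‖mass a s‖ ^ 2 ≤ a ^ 2 + |s| := by
  rw [← norm_pow, mass_sq]
  refine (norm_add_le _ _).trans_eq ?_
  simp

lemma sq_le_mul_mass_re_sub (a s : ℝ) :
    s ^ 2 ≤ 8 * ‖mass a s‖ ^ 3 * ((mass a s).re - |a|) := by
  set μ := mass a s with hμ
  have hsq := mass_sq a s
  have hre : μ.re ^ 2 - μ.im ^ 2 = |a| ^ 2 := by
    simpa [← ofReal_pow, sq, ← hμ] using congrArg re hsq
  have him : 2 * (μ.re * μ.im) = s := by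
    have := congrArg im hsq
    simp only [← hμ, sq, mul_im, add_im, ← ofReal_mul, ofReal_im, ofReal_re, I_re, I_im] at this
    linarith
  have ha : |a| ≤ μ.re := abs_le_mass_re a s
  have hn : μ.re ≤ ‖μ‖ := re_le_norm μ
  have hnonneg : 0 ≤ μ.re := (abs_nonneg a).trans ha
  calc s ^ 2 = 4 * μ.re ^ 2 * (μ.re + |a|) * (μ.re - |a|) := by
        rw [← him]
        linear_combination (-4) * μ.re ^ 2 * hre
    _ ≤ 4 * ‖μ‖ ^ 2 * (‖μ‖ + ‖μ‖) * (μ.re - |a|) := by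
        have := sub_nonneg.2 ha
        gcongr
        exact ha.trans hn
    _ = _ := by ring

lemma norm_mass_sub_mass_mul_re_le (a s s' : ℝ) :
    ‖mass a s - mass a s'‖ * (mass a s).re ≤ |s - s'| := by
  have hprod : (mass a s - mass a s') * (mass a s + mass a s') = I * (s - s' : ℝ) := by
    push_cast
    linear_combination mass_sq a s - mass_sq a s'
  have hre : (mass a s).re ≤ ‖mass a s + mass a s'‖ := by
    refine le_trans ?_ (re_le_norm _)
    rw [add_re]
    linarith [(abs_nonneg a).trans (abs_le_mass_re a s')]
  calc _ ≤ ‖mass a s - mass a s'‖ * ‖mass a s + mass a s'‖ := by gcongr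
    _ = |s - s'| := by
        rw [← norm_mul, hprod, norm_mul, norm_I, one_mul, norm_real, Real.norm_eq_abs]

lemma one_le_abs_intCast {k : ℤ} (hk : k ≠ 0) : 1 ≤ |(k : ℝ)| := by
  exact_mod_cast Int.one_le_abs hk

/-- The complex numbers `μ` with `a + c s ≤ Re μ` and `|μ| ≤ M s`: the region containing the masses
of frequency about `s²`. -/
def massRegion (a c M s : ℝ) : Set ℂ := {μ | a + c * s ≤ μ.re ∧ ‖μ‖ ≤ M * s}

lemma convex_massRegion (a c M s : ℝ) : Convex ℝ (massRegion a c M s) := by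
  have hinter : massRegion a c M s = {μ | a + c * s ≤ μ.re} ∩ Metric.closedBall 0 (M * s) := by
    ext μ
    simp [massRegion]
  exact hinter ▸ (convex_halfSpace_re_ge _).inter (convex_closedBall _ _)

lemma exists_mass_mem_massRegion (a : ℝ) {ϖ : ℝ} (hϖ : 0 < ϖ) :
    ∃ c > 0, ∃ M > 0, ∀ k : ℤ, k ≠ 0 → mass a (ϖ * k) ∈ massRegion |a| c M √|(k : ℝ)| := by
  set M := √(a ^ 2 + ϖ)
  have hM : 0 < M := Real.sqrt_pos.2 (by positivity)
  refine ⟨ϖ ^ 2 / (8 * M ^ 3), by positivity, M, hM, fun k hk => ?_⟩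
  have hk1 := one_le_abs_intCast hk
  have hk0 : 0 < √|(k : ℝ)| := Real.sqrt_pos.2 (one_pos.trans_le hk1)
  have hks : √|(k : ℝ)| ^ 2 = |(k : ℝ)| := Real.sq_sqrt (abs_nonneg _)
  have hnorm : ‖mass a (ϖ * k)‖ ≤ M * √|(k : ℝ)| := by
    refine (pow_le_pow_iff_left₀ (norm_nonneg _) (by positivity) two_ne_zero).1 ?_
    rw [mul_pow, hks, Real.sq_sqrt (by positivity)]
    refine (norm_mass_sq_le _ _).trans ?_
    rw [abs_mul, abs_of_pos hϖ, add_mul]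
    gcongr
    exact le_mul_of_one_le_right (sq_nonneg a) hk1
  refine ⟨?_, hnorm⟩
  have hgap : (ϖ * k) ^ 2 ≤ 8 * (M * √|(k : ℝ)|) ^ 3 * ((mass a (ϖ * k)).re - |a|) :=
    (sq_le_mul_mass_re_sub a (ϖ * k)).trans <|
      mul_le_mul_of_nonneg_right (by gcongr) (sub_nonneg.2 (abs_le_mass_re _ _))
  rw [mul_pow ϖ, ← sq_abs (k : ℝ)] at hgap
  have hdiv : ϖ ^ 2 / (8 * M ^ 3) * √|(k : ℝ)| ≤ (mass a (ϖ * k)).re - |a| := by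
    rw [div_mul_eq_mul_div, div_le_iff₀ (by positivity)]
    refine le_of_mul_le_mul_right ?_ (pow_pos hk0 3)
    calc _ = ϖ ^ 2 * (√|(k : ℝ)| ^ 2) ^ 2 := by ring
      _ ≤ 8 * (M * √|(k : ℝ)|) ^ 3 * ((mass a (ϖ * k)).re - |a|) := by rwa [hks]
      _ = _ := by ring
  linarith

lemma massRegion_mono {a c c' M M' s s' : ℝ} (hc : c' * s' ≤ c * s) (hM : M * s ≤ M' * s') :
    massRegion a c M s ⊆ massRegion a c' M' s' :=
  fun _ hμ => ⟨(add_le_add_right hc a).trans hμ.1, hμ.2.trans hM⟩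

end Mass

section Admissible

lemma sqrt_abs_intCast_pos {k : ℤ} (hk : k ≠ 0) : 0 < √|(k : ℝ)| :=
  Real.sqrt_pos.2 (abs_pos.2 (Int.cast_ne_zero.2 hk))

lemma one_le_sqrt_abs_intCast {k : ℤ} (hk : k ≠ 0) : 1 ≤ √|(k : ℝ)| :=
  Real.one_le_sqrt.2 (one_le_abs_intCast hk)

lemma sqrt_abs_le_two_mul {k l : ℤ} (hl : l ≠ 0) (hkl : |k - l| ≤ 1) :
    √|(k : ℝ)| ≤ 2 * √|(l : ℝ)| := by
  rw [show (2 : ℝ) = √4 by rw [show (4 : ℝ) = 2 ^ 2 by norm_num, Real.sqrt_sq two_pos.le],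
    ← Real.sqrt_mul (by norm_num)]
  refine Real.sqrt_le_sqrt ?_
  have hl1 := one_le_abs_intCast hl
  have hkl1 : |(k : ℝ) - l| ≤ 1 := by exact_mod_cast hkl
  linarith [abs_sub_abs_le_abs_sub (k : ℝ) l]

lemma exists_mass_mem_massRegion_and_norm_sub_le (a : ℝ) {ϖ : ℝ} (hϖ : 0 < ϖ) :
    ∃ c > 0, ∃ M > 0, ∀ k : ℤ, k ≠ 0 → mass a (ϖ * k) ∈ massRegion |a| c M √|(k : ℝ)| ∧
      (k ≠ 1 → mass a (ϖ * (k - 1 : ℤ)) ∈ massRegion |a| c M √|(k : ℝ)| ∧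
        ‖mass a (ϖ * k) - mass a (ϖ * (k - 1 : ℤ))‖ ≤ M / √|(k : ℝ)|) := by
  obtain ⟨c, hc, M, hM, hmem⟩ := exists_mass_mem_massRegion a hϖ
  refine ⟨c / 2, half_pos hc, 2 * M + ϖ / c, by positivity, fun k hk => ?_⟩
  have hk0 := sqrt_abs_intCast_pos hk
  refine ⟨massRegion_mono (by nlinarith) ?_ (hmem k hk), fun hk1 => ⟨?_, ?_⟩⟩
  · gcongr
    have : 0 < ϖ / c := by positivity
    linarith
  · have hpred : k - 1 ≠ 0 := sub_ne_zero.2 hk1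
    have hle := sqrt_abs_le_two_mul (k := k) hpred (by simp)
    have hge := sqrt_abs_le_two_mul (k := k - 1) hk (by simp)
    refine massRegion_mono ?_ ?_ (hmem (k - 1) hpred)
    · linarith [mul_le_mul_of_nonneg_left hle hc.le]
    · calc M * √|((k - 1 : ℤ) : ℝ)| ≤ M * (2 * √|(k : ℝ)|) := by gcongr
        _ ≤ (2 * M + ϖ / c) * √|(k : ℝ)| := by
          rw [add_mul, ← mul_assoc, mul_comm M 2]
          exact le_add_of_nonneg_right (by positivity)
  · have hre : c * √|(k : ℝ)| ≤ (mass a (ϖ * k)).re := by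
      linarith [(hmem k hk).1, abs_nonneg a]
    have hdiff := norm_mass_sub_mass_mul_re_le a (ϖ * k) (ϖ * (k - 1 : ℤ))
    rw [show ϖ * k - ϖ * (k - 1 : ℤ) = ϖ by push_cast; ring, abs_of_pos hϖ] at hdiff
    calc _ ≤ ϖ / (c * √|(k : ℝ)|) := by
          rw [le_div_iff₀ (by positivity)]
          exact (mul_le_mul_of_nonneg_left hre (norm_nonneg _)).trans hdiff
      _ ≤ _ := by
          rw [← div_div]
          gcongr
          linarith

/-- The family obtained from functions `Y μ` of the mass `μ` by inserting the masses
`√(a² + iϖk)`, with no contribution of the frequency `k = 0`. -/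
def massFamily {V F : Type*} [Zero F] (a ϖ : ℝ) (Y : ℂ → V → F) (k : ℤ) : V → F :=
  if k = 0 then 0 else Y (mass a (ϖ * k))

lemma massFamily_of_ne_zero {V F : Type*} [Zero F] (a ϖ : ℝ) (Y : ℂ → V → F) {k : ℤ}
    (hk : k ≠ 0) : massFamily a ϖ Y k = Y (mass a (ϖ * k)) := if_neg hk

variable {V F : Type*} [NormedAddCommGroup V] [NormedAddCommGroup F]

/-- A family of functions `Q k` on `V ∖ {0}`, `k ≠ 0`, that is singular of order `m + 1` at the
origin and decays like `e^{-b√|k|‖x‖}`, and whose increments in `k` gain the factor `‖x‖ / √|k|`. -/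
structure IsAdmissible (m : ℕ) (b C : ℝ) (Q : ℤ → V → F) : Prop where
  rate_pos : 0 < b
  const_nonneg : 0 ≤ C
  zero : Q 0 = 0
  continuousOn : ∀ k, ContinuousOn (Q k) {0}ᶜ
  norm_le : ∀ k, k ≠ 0 → ∀ x, x ≠ 0 →
    ‖Q k x‖ ≤ C / ‖x‖ ^ (m + 1) * Real.exp (-(b * √|(k : ℝ)| * ‖x‖))
  norm_sub_le : ∀ k, k ≠ 0 → k ≠ 1 → ∀ x, x ≠ 0 →
    ‖Q k x - Q (k - 1) x‖ ≤ C / ‖x‖ ^ m * (Real.exp (-(b * √|(k : ℝ)| * ‖x‖)) / √|(k : ℝ)|)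

lemma exists_isAdmissible_massFamily [NormedSpace ℂ F] {m : ℕ} (a : ℝ) {ϖ : ℝ} (hϖ : 0 < ϖ)
    {Y Y' : ℂ → V → F} (hcont : ∀ μ, ContinuousOn (Y μ) {0}ᶜ)
    (hderiv : ∀ μ x, HasDerivAt (fun μ => Y μ x) (Y' μ x) μ)
    (hbound : ∀ c > 0, ∀ M > 0, ∃ b > 0, ∃ C ≥ 0, ∀ s ≥ 1, ∀ μ ∈ massRegion |a| c M s,
      ∀ x, x ≠ 0 → ‖Y μ x‖ ≤ C / ‖x‖ ^ (m + 1) * Real.exp (-(b * s * ‖x‖)) ∧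
        ‖Y' μ x‖ ≤ C / ‖x‖ ^ m * Real.exp (-(b * s * ‖x‖))) :
    ∃ b C, IsAdmissible m b C (massFamily a ϖ Y) := by
  obtain ⟨c, hc, M, hM, hmass⟩ := exists_mass_mem_massRegion_and_norm_sub_le a hϖ
  obtain ⟨b, hb, C, hC, hY⟩ := hbound c hc M hM
  refine ⟨b, C * (1 + M), hb, by positivity, by simp [massFamily], fun k => ?_,
    fun k hk x hx => ?_, fun k hk hk1 x hx => ?_⟩
  · obtain rfl | hk := eq_or_ne k 0
    · exact continuousOn_const
    · rw [massFamily_of_ne_zero a ϖ Y hk]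
      exact hcont _
  · rw [massFamily_of_ne_zero a ϖ Y hk]
    refine ((hY _ (one_le_sqrt_abs_intCast hk) _ (hmass k hk).1 x hx).1).trans ?_
    gcongr
    exact le_mul_of_one_le_right hC (by linarith)
  · obtain ⟨hmem, hpred⟩ := hmass k hk
    obtain ⟨hmem', hsub⟩ := hpred hk1
    rw [massFamily_of_ne_zero a ϖ Y hk, massFamily_of_ne_zero a ϖ Y (sub_ne_zero.2 hk1)]
    calc _ ≤ C / ‖x‖ ^ m * Real.exp (-(b * √|(k : ℝ)| * ‖x‖)) * (M / √|(k : ℝ)|) := by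
          refine ((convex_massRegion _ _ _ _).norm_image_sub_le_of_norm_hasDerivWithin_le
            (fun μ _ => (hderiv μ x).hasDerivWithinAt)
            (fun μ hμ => (hY _ (one_le_sqrt_abs_intCast hk) μ hμ x hx).2) hmem' hmem).trans ?_
          gcongr
      _ = C * M / ‖x‖ ^ m * (Real.exp (-(b * √|(k : ℝ)| * ‖x‖)) / √|(k : ℝ)|) := by ring
      _ ≤ _ := by
          gcongr
          linarith

lemma exp_mass_le {v : V} {c M s : ℝ} {μ : ℂ} (hμ : μ ∈ massRegion |‖v‖| c M s) (x : V) :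
    Real.exp (-((μ.re - ‖v‖) * ‖x‖)) ≤ Real.exp (-(c * s * ‖x‖)) := by
  have := hμ.1
  rw [abs_norm] at this
  gcongr
  linarith

variable [InnerProductSpace ℝ V]

lemma exists_isAdmissible_yukawa (v : V) {ϖ : ℝ} (hϖ : 0 < ϖ) :
    ∃ b C, IsAdmissible 0 b C (massFamily ‖v‖ ϖ fun μ (x : V) => yukawa μ v ‖x‖ x) := by
  refine exists_isAdmissible_massFamily ‖v‖ hϖ (fun μ => ?_)
    (fun μ x => hasDerivAt_yukawa_mass v μ x) fun c hc M _ => ⟨c, hc, 1, zero_le_one,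
      fun s _ μ hμ x hx => ⟨?_, ?_⟩⟩
  · exact fun x hx => (hasFDerivAt_yukawa_norm μ v hx).continuousAt.continuousWithinAt
  · rw [zero_add, pow_one, one_div]
    refine (norm_yukawa_le μ v le_rfl).trans ?_
    gcongr ?_ * ?_
    exact exp_mass_le hμ x
  · rw [norm_neg, norm_mul, norm_real, norm_norm, pow_zero, div_one, one_mul]
    calc ‖x‖ * ‖yukawa μ v ‖x‖ x‖ ≤ ‖x‖ * (‖x‖⁻¹ * Real.exp (-((μ.re - ‖v‖) * ‖x‖))) := by
          gcongr
          exact norm_yukawa_le μ v le_rfl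
      _ = Real.exp (-((μ.re - ‖v‖) * ‖x‖)) := mul_inv_cancel_left₀ (norm_ne_zero_iff.2 hx) _
      _ ≤ _ := exp_mass_le hμ x

lemma exp_neg_mul_affine_le {b L r s : ℝ} (hb : 0 < b) (hL : 0 ≤ L) (hr : 0 < r) (hs : 0 ≤ s) :
    Real.exp (-(2 * b * s * r)) * (L * s + 2 * r⁻¹) ≤
      (L / b + 2) / r * Real.exp (-(b * s * r)) := by
  have hs_le : s ≤ (b * r)⁻¹ * Real.exp (b * s * r) := by
    rw [inv_mul_eq_div, le_div_iff₀ (by positivity)]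
    linarith [Real.add_one_le_exp (b * s * r)]
  have hone : 1 ≤ Real.exp (b * s * r) := Real.one_le_exp (by positivity)
  calc _ ≤ Real.exp (-(2 * b * s * r)) *
        (L * ((b * r)⁻¹ * Real.exp (b * s * r)) + 2 * r⁻¹ * Real.exp (b * s * r)) := by
        gcongr ?_ * (L * ?_ + ?_)
        exact le_mul_of_one_le_right (by positivity) hone
    _ = (L / b + 2) / r * (Real.exp (-(2 * b * s * r)) * Real.exp (b * s * r)) := by
        field_simp
    _ = _ := by
        rw [← Real.exp_add]
        ring_nf

lemma continuousOn_yukawaDeriv_norm (μ : ℂ) (v : V) :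
    ContinuousOn (fun x : V => yukawaDeriv μ v ‖x‖ x) {0}ᶜ := by
  have hyukawa : ContinuousOn (fun x : V => yukawa μ v ‖x‖ x) {0}ᶜ := fun x hx =>
    (hasFDerivAt_yukawa_norm μ v hx).continuousAt.continuousWithinAt
  have hinv : ContinuousOn (fun x : V => (‖x‖ : ℂ)⁻¹) {0}ᶜ :=
    (continuous_ofReal.comp continuous_norm).continuousOn.inv₀ (by simp)
  have hform : Continuous fun x : V => innerForm x := continuous_innerForm
  unfold yukawaDeriv
  fun_prop

lemma exists_isAdmissible_yukawaDeriv (v : V) {ϖ : ℝ} (hϖ : 0 < ϖ) :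
    ∃ b C, IsAdmissible 1 b C (massFamily ‖v‖ ϖ fun μ (x : V) => yukawaDeriv μ v ‖x‖ x) := by
  refine exists_isAdmissible_massFamily ‖v‖ hϖ (fun μ => continuousOn_yukawaDeriv_norm μ v)
    (fun μ x => hasDerivAt_yukawaDeriv_mass v μ x) fun c hc M hM => ⟨c / 2, half_pos hc,
      (‖v‖ + M) / (c / 2) + 2, by positivity, fun s hs μ hμ x hx => ?_⟩
  have hr : 0 < ‖x‖ := norm_pos_iff.2 hx
  have hfactor : ‖v‖ + ‖μ‖ ≤ (‖v‖ + M) * s := by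
    rw [add_mul]
    exact add_le_add (le_mul_of_one_le_right (norm_nonneg v) hs) hμ.2
  have hmain : Real.exp (-((μ.re - ‖v‖) * ‖x‖)) * (‖v‖ + ‖μ‖ + 2 * ‖x‖⁻¹) ≤
      ((‖v‖ + M) / (c / 2) + 2) / ‖x‖ * Real.exp (-(c / 2 * s * ‖x‖)) := by
    refine le_trans ?_ (exp_neg_mul_affine_le (half_pos hc) (by positivity) hr (by linarith))
    rw [mul_div_cancel₀ c two_ne_zero]
    gcongr ?_ * (?_ + _)
    exact exp_mass_le hμ x
  refine ⟨?_, (norm_yukawaDeriv_mass_le v μ hx).trans (by simpa using hmain)⟩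
  calc _ ≤ ‖x‖⁻¹ * (Real.exp (-((μ.re - ‖v‖) * ‖x‖)) * (‖v‖ + ‖μ‖ + 2 * ‖x‖⁻¹)) := by
        refine (norm_yukawaDeriv_le μ v le_rfl).trans ?_
        rw [mul_assoc]
        gcongr
        linarith [inv_pos.2 hr]
    _ ≤ ‖x‖⁻¹ * (((‖v‖ + M) / (c / 2) + 2) / ‖x‖ * Real.exp (-(c / 2 * s * ‖x‖))) := by gcongr
    _ = _ := by ring

end Admissible

section SqrtWeight

/-- The weight `e^{-β√|k|} / √|k|` on the integers; division by zero makes it vanish at `k = 0`. -/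
def sqrtWeight (β : ℝ) (k : ℤ) : ℝ := Real.exp (-(β * √|(k : ℝ)|)) / √|(k : ℝ)|

lemma sqrtWeight_nonneg (β : ℝ) (k : ℤ) : 0 ≤ sqrtWeight β k := by
  unfold sqrtWeight
  positivity

lemma sqrtWeight_zero (β : ℝ) : sqrtWeight β 0 = 0 := by simp [sqrtWeight]

lemma sqrtWeight_neg (β : ℝ) (k : ℤ) : sqrtWeight β (-k) = sqrtWeight β k := by
  simp only [sqrtWeight, Int.cast_neg, abs_neg]

lemma sqrtWeight_natCast_add_one_le {β : ℝ} (hβ : 0 < β) (n : ℕ) :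
    sqrtWeight β (n + 1 : ℕ) ≤
      2 / β * (Real.exp (-(β * √(n : ℝ))) - Real.exp (-(β * √((n + 1 : ℕ) : ℝ)))) := by
  have hv0 : 0 < √((n + 1 : ℕ) : ℝ) := by positivity
  have hsq : √((n + 1 : ℕ) : ℝ) ^ 2 - √(n : ℝ) ^ 2 = 1 := by
    rw [Real.sq_sqrt (by positivity), Real.sq_sqrt (by positivity)]
    push_cast
    ring
  have huv : √(n : ℝ) ≤ √((n + 1 : ℕ) : ℝ) := by
    gcongr
    exact n.le_succ
  rw [sqrtWeight, Int.cast_natCast, Nat.abs_cast]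
  generalize √((n + 1 : ℕ) : ℝ) = v at *
  generalize √(n : ℝ) = u at *
  have hinv : 1 / v ≤ 2 * (v - u) := by
    rw [div_le_iff₀ hv0]
    nlinarith
  have hexp : β * (v - u) * Real.exp (-(β * v)) ≤ Real.exp (-(β * u)) - Real.exp (-(β * v)) := by
    rw [show -(β * u) = β * (v - u) + -(β * v) by ring, Real.exp_add, ← sub_one_mul]
    gcongr
    linarith [Real.add_one_le_exp (β * (v - u))]
  calc _ = Real.exp (-(β * v)) * (1 / v) := div_eq_mul_one_div _ _
    _ ≤ Real.exp (-(β * v)) * (2 * (v - u)) := by gcongr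
    _ = 2 / β * (β * (v - u) * Real.exp (-(β * v))) := by field_simp
    _ ≤ _ := by gcongr

lemma sum_range_sqrtWeight_le {β : ℝ} (hβ : 0 < β) (N : ℕ) :
    ∑ n ∈ Finset.range N, sqrtWeight β (n + 1 : ℕ) ≤ 2 / β := by
  refine (Finset.sum_le_sum fun n _ => sqrtWeight_natCast_add_one_le hβ n).trans ?_
  rw [← Finset.mul_sum, Finset.sum_range_sub' fun n : ℕ => Real.exp (-(β * √(n : ℝ)))]
  refine mul_le_of_le_one_right (by positivity) ?_
  simp [Real.exp_nonneg]

lemma summable_sqrtWeight_natCast {β : ℝ} (hβ : 0 < β) :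
    Summable fun n : ℕ => sqrtWeight β (n + 1) :=
  summable_of_sum_range_le (fun _ => sqrtWeight_nonneg _ _) (sum_range_sqrtWeight_le hβ)

lemma summable_sqrtWeight {β : ℝ} (hβ : 0 < β) : Summable (sqrtWeight β) :=
  .of_add_one_of_neg_add_one (summable_sqrtWeight_natCast hβ)
    (by simpa only [sqrtWeight_neg] using summable_sqrtWeight_natCast hβ)

lemma tsum_sqrtWeight_le {β : ℝ} (hβ : 0 < β) : ∑' k, sqrtWeight β k ≤ 4 / β := by
  have hnat := summable_sqrtWeight_natCast hβ
  have hle : ∑' n : ℕ, sqrtWeight β (n + 1) ≤ 2 / β :=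
    Real.tsum_le_of_sum_range_le (fun _ => sqrtWeight_nonneg _ _) (sum_range_sqrtWeight_le hβ)
  rw [tsum_of_add_one_of_neg_add_one hnat (by simpa only [sqrtWeight_neg] using hnat)]
  simp only [sqrtWeight_neg, sqrtWeight_zero]
  linarith [show 4 / β = 2 / β + 2 / β by ring]

lemma exp_neg_div_sqrt_le {β : ℝ} (hβ : 0 < β) {k : ℤ} (hk : k ≠ 0) :
    Real.exp (-(4 * β * √|(k : ℝ)|)) / √|(k : ℝ)| ≤ Real.exp (-(2 * β)) * sqrtWeight β k := by
  have hs := one_le_sqrt_abs_intCast hk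
  rw [sqrtWeight, ← mul_div_assoc, ← Real.exp_add]
  gcongr
  nlinarith

lemma exp_neg_sqrt_le {β : ℝ} (hβ : 0 < β) {k : ℤ} (hk : k ≠ 0) :
    Real.exp (-(4 * β * √|(k : ℝ)|)) ≤ β⁻¹ * Real.exp (-(2 * β)) * sqrtWeight β k := by
  have hs := one_le_sqrt_abs_intCast hk
  have hs_le : √|(k : ℝ)| ≤ β⁻¹ * Real.exp (β * √|(k : ℝ)|) := by
    rw [inv_mul_eq_div, le_div_iff₀ hβ]
    linarith [Real.add_one_le_exp (β * √|(k : ℝ)|)]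
  rw [sqrtWeight, ← mul_div_assoc, le_div_iff₀ (sqrt_abs_intCast_pos hk)]
  calc _ ≤ Real.exp (-(4 * β * √|(k : ℝ)|)) * (β⁻¹ * Real.exp (β * √|(k : ℝ)|)) := by gcongr
    _ = β⁻¹ * Real.exp (-(3 * β * √|(k : ℝ)|)) := by
      rw [mul_left_comm, ← Real.exp_add]
      ring_nf
    _ ≤ β⁻¹ * Real.exp (-(2 * β) + -(β * √|(k : ℝ)|)) := by
      gcongr
      nlinarith
    _ = _ := by rw [Real.exp_add, mul_assoc]

end SqrtWeight

namespace IsAdmissible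

variable {V F : Type*} [NormedAddCommGroup V] [NormedAddCommGroup F]
variable {m : ℕ} {b C r : ℝ} {Q : ℤ → V → F} {x : V}

lemma norm_le_sqrtWeight (h : IsAdmissible m b C Q) (hr : 0 < r) (hx : r ≤ ‖x‖) (k : ℤ) :
    ‖Q k x‖ ≤ C / r ^ (m + 1) *
      ((b * r / 4)⁻¹ * Real.exp (-(2 * (b * r / 4))) * sqrtWeight (b * r / 4) k) := by
  have hb := h.rate_pos
  have hC := h.const_nonneg
  obtain rfl | hk := eq_or_ne k 0
  · simp [h.zero, sqrtWeight_zero]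
  · refine (h.norm_le k hk x (norm_pos_iff.1 (hr.trans_le hx))).trans ?_
    calc _ ≤ C / r ^ (m + 1) * Real.exp (-(b * √|(k : ℝ)| * r)) := by gcongr
      _ = C / r ^ (m + 1) * Real.exp (-(4 * (b * r / 4) * √|(k : ℝ)|)) := by ring_nf
      _ ≤ _ := by
        gcongr
        exact exp_neg_sqrt_le (by positivity) hk

lemma summable_norm (h : IsAdmissible m b C Q) (hx : x ≠ 0) : Summable fun k => ‖Q k x‖ := by
  have hb := h.rate_pos
  have hr : 0 < ‖x‖ := norm_pos_iff.2 hx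
  exact .of_nonneg_of_le (fun _ => norm_nonneg _) (h.norm_le_sqrtWeight hr le_rfl)
    (((summable_sqrtWeight (by positivity)).mul_left _).mul_left _)

lemma tsum_norm_le (h : IsAdmissible m b C Q) (hx : x ≠ 0) :
    ∑' k, ‖Q k x‖ ≤ 64 * C / b ^ 2 / ‖x‖ ^ (m + 3) * Real.exp (-(b / 2 * ‖x‖)) := by
  have hb := h.rate_pos
  have hC := h.const_nonneg
  have hr : 0 < ‖x‖ := norm_pos_iff.2 hx
  have hβ : 0 < b * ‖x‖ / 4 := by positivity
  calc _ ≤ C / ‖x‖ ^ (m + 1) * ((b * ‖x‖ / 4)⁻¹ * Real.exp (-(2 * (b * ‖x‖ / 4))) *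
        ∑' k, sqrtWeight (b * ‖x‖ / 4) k) := by
        rw [← tsum_mul_left, ← tsum_mul_left]
        exact (h.summable_norm hx).tsum_le_tsum (h.norm_le_sqrtWeight hr le_rfl)
          (((summable_sqrtWeight hβ).mul_left _).mul_left _)
    _ ≤ C / ‖x‖ ^ (m + 1) * ((b * ‖x‖ / 4)⁻¹ * Real.exp (-(2 * (b * ‖x‖ / 4))) *
        (4 / (b * ‖x‖ / 4))) := by
        gcongr
        exact tsum_sqrtWeight_le hβ
    _ = _ := by
        rw [show 2 * (b * ‖x‖ / 4) = b / 2 * ‖x‖ by ring]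
        field_simp
        ring

lemma norm_sub_le_sqrtWeight_add (h : IsAdmissible m b C Q) (hx : x ≠ 0) (k : ℤ) :
    ‖Q k x - Q (k - 1) x‖ ≤
      C / ‖x‖ ^ m * (Real.exp (-(b / 2 * ‖x‖)) * sqrtWeight (b * ‖x‖ / 4) k) +
        ((Pi.single 0 (C / ‖x‖ ^ (m + 1) * Real.exp (-(b / 2 * ‖x‖))) : ℤ → ℝ) k +
          (Pi.single 1 (C / ‖x‖ ^ (m + 1) * Real.exp (-(b / 2 * ‖x‖))) : ℤ → ℝ) k) := by
  have hb := h.rate_pos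
  have hC := h.const_nonneg
  have hr : 0 < ‖x‖ := norm_pos_iff.2 hx
  have hunit : ∀ l : ℤ, |(l : ℝ)| = 1 →
      ‖Q l x‖ ≤ C / ‖x‖ ^ (m + 1) * Real.exp (-(b / 2 * ‖x‖)) := fun l hl => by
    refine (h.norm_le l (by rintro rfl; simp at hl) x hx).trans ?_
    rw [hl, Real.sqrt_one, mul_one]
    gcongr
    linarith
  have hweight := sqrtWeight_nonneg (b * ‖x‖ / 4) k
  obtain rfl | hk := eq_or_ne k 0
  · rw [h.zero, Pi.zero_apply, zero_sub, norm_neg, Pi.single_eq_same,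
      Pi.single_eq_of_ne zero_ne_one, add_zero]
    exact le_add_of_nonneg_of_le (by positivity) (hunit _ (by simp))
  obtain rfl | hk1 := eq_or_ne k 1
  · rw [sub_self, h.zero, Pi.zero_apply, sub_zero, Pi.single_eq_same,
      Pi.single_eq_of_ne one_ne_zero, zero_add]
    exact le_add_of_nonneg_of_le (by positivity) (hunit 1 (by simp))
  · rw [Pi.single_eq_of_ne hk, Pi.single_eq_of_ne hk1, add_zero, add_zero]
    refine (h.norm_sub_le k hk hk1 x hx).trans ?_
    have hdecay := exp_neg_div_sqrt_le (β := b * ‖x‖ / 4) (by positivity) hk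
    rw [show 2 * (b * ‖x‖ / 4) = b / 2 * ‖x‖ by ring] at hdecay
    gcongr
    refine Eq.trans_le ?_ hdecay
    ring_nf

lemma tsum_norm_sub_le (h : IsAdmissible m b C Q) (hx : x ≠ 0) :
    ∑' k, ‖Q k x - Q (k - 1) x‖ ≤
      (16 / b + 2) * C / ‖x‖ ^ (m + 1) * Real.exp (-(b / 2 * ‖x‖)) := by
  have hb := h.rate_pos
  have hC := h.const_nonneg
  have hr : 0 < ‖x‖ := norm_pos_iff.2 hx
  have hβ : 0 < b * ‖x‖ / 4 := by positivity
  have hweight := ((summable_sqrtWeight hβ).mul_left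
    (Real.exp (-(b / 2 * ‖x‖)))).mul_left (C / ‖x‖ ^ m)
  have hexceptional := (hasSum_pi_single 0 (C / ‖x‖ ^ (m + 1) * Real.exp (-(b / 2 * ‖x‖)))).add
    (hasSum_pi_single (1 : ℤ) (C / ‖x‖ ^ (m + 1) * Real.exp (-(b / 2 * ‖x‖))))
  have hmajorant := hweight.add hexceptional.summable
  refine ((Summable.of_nonneg_of_le (fun _ => norm_nonneg _) (h.norm_sub_le_sqrtWeight_add hx)
    hmajorant).tsum_le_tsum (h.norm_sub_le_sqrtWeight_add hx) hmajorant).trans ?_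
  rw [hweight.tsum_add hexceptional.summable, hexceptional.tsum_eq, tsum_mul_left, tsum_mul_left]
  calc _ ≤ C / ‖x‖ ^ m * (Real.exp (-(b / 2 * ‖x‖)) * (4 / (b * ‖x‖ / 4))) +
        (C / ‖x‖ ^ (m + 1) * Real.exp (-(b / 2 * ‖x‖)) +
          C / ‖x‖ ^ (m + 1) * Real.exp (-(b / 2 * ‖x‖))) := by
        gcongr
        exact tsum_sqrtWeight_le hβ
    _ = _ := by
        field_simp
        ring

end IsAdmissible

section Circle

variable {T : ℝ} {V F : Type*} [NormedAddCommGroup V] [NormedAddCommGroup F] [NormedSpace ℂ F]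

lemma norm_fourier_apply (k : ℤ) (t : AddCircle T) : ‖fourier k t‖ = 1 := by
  rw [fourier_apply]
  exact Circle.norm_coe _

lemma norm_fourier_smul (k : ℤ) (t : AddCircle T) (z : F) : ‖fourier k t • z‖ = ‖z‖ := by
  rw [norm_smul, norm_fourier_apply, one_mul]

lemma norm_tsum_fourier_smul_le {a : ℤ → F} (ha : Summable fun k => ‖a k‖) (t : AddCircle T) :
    ‖∑' k, fourier k t • a k‖ ≤ ∑' k, ‖a k‖ := by
  simpa only [norm_fourier_smul] using
    norm_tsum_le_tsum_norm (f := fun k => fourier k t • a k) (by simpa only [norm_fourier_smul])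

variable [CompleteSpace F]

lemma summable_fourier_smul {a : ℤ → F} (ha : Summable fun k => ‖a k‖) (t : AddCircle T) :
    Summable fun k => fourier k t • a k :=
  .of_norm (by simpa only [norm_fourier_smul])

lemma norm_fourier_one_sub_one_mul_norm_tsum_le {a : ℤ → F} (ha : Summable fun k => ‖a k‖)
    (t : AddCircle T) :
    ‖fourier 1 t - 1‖ * ‖∑' k, fourier k t • a k‖ ≤ ∑' k, ‖a k - a (k - 1)‖ := by
  have ha' : Summable fun k => ‖a (k - 1)‖ := ha.comp_injective (sub_left_injective (b := (1 : ℤ)))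
  have hshift : fourier 1 t • ∑' k, fourier k t • a k = ∑' k, fourier k t • a (k - 1) := by
    rw [← (summable_fourier_smul ha t).tsum_const_smul, ← (Equiv.subRight (1 : ℤ)).tsum_eq]
    refine tsum_congr fun k => ?_
    rw [Equiv.subRight_apply, smul_smul, ← fourier_add, add_sub_cancel]
  have hparts : (fourier 1 t - 1) • ∑' k, fourier k t • a k =
      ∑' k, fourier k t • (a (k - 1) - a k) := by
    rw [sub_smul, one_smul, hshift,
      ← (summable_fourier_smul ha' t).tsum_sub (summable_fourier_smul ha t)]
    simp_rw [smul_sub]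
  rw [← norm_smul, hparts, tsum_congr fun k => norm_sub_rev (a k) (a (k - 1))]
  exact norm_tsum_fourier_smul_le
    (.of_nonneg_of_le (fun _ => norm_nonneg _) (fun _ => norm_sub_le _ _) (ha'.add ha)) t

lemma norm_tsum_fourier_smul_le_interpolation {a : ℤ → F} (ha : Summable fun k => ‖a k‖)
    {t : AddCircle T} (ht : 0 < ‖fourier 1 t - 1‖) {γ A₀ A₁ : ℝ} (hγ0 : 0 ≤ γ) (hγ1 : γ ≤ 1)
    (h0 : ∑' k, ‖a k‖ ≤ A₀) (h1 : ∑' k, ‖a k - a (k - 1)‖ ≤ A₁) :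
    ‖∑' k, fourier k t • a k‖ ≤ A₀ ^ γ * A₁ ^ (1 - γ) * ‖fourier 1 t - 1‖ ^ (-(1 - γ)) := by
  set f := ‖∑' k, fourier k t • a k‖
  have hf0 : 0 ≤ f := norm_nonneg _
  have hA0 : f ≤ A₀ := (norm_tsum_fourier_smul_le ha t).trans h0
  have hA1 : f ≤ A₁ / ‖fourier 1 t - 1‖ := by
    rw [le_div_iff₀ ht, mul_comm]
    exact (norm_fourier_one_sub_one_mul_norm_tsum_le ha t).trans h1
  have hA1' : 0 ≤ A₁ := (tsum_nonneg fun k => norm_nonneg _).trans h1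
  have hA0' : 0 ≤ A₀ := hf0.trans hA0
  have hγ : 0 ≤ 1 - γ := sub_nonneg.2 hγ1
  calc f = f ^ γ * f ^ (1 - γ) := by
        rw [← Real.rpow_add_of_nonneg hf0 hγ0 hγ, add_sub_cancel, Real.rpow_one]
    _ ≤ A₀ ^ γ * (A₁ / ‖fourier 1 t - 1‖) ^ (1 - γ) := by gcongr
    _ = _ := by rw [Real.div_rpow hA1' ht.le, Real.rpow_neg ht.le, div_eq_mul_inv, mul_assoc]

/-- The function on `𝕋 × V` whose Fourier coefficients in time are the functions `Q k`. -/
def modeSum (Q : ℤ → V → F) (t : AddCircle T) (x : V) : F := ∑' k : ℤ, fourier k t • Q k x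

lemma rpow_mul_rpow_one_sub_div_pow {K r : ℝ} (hK : 0 ≤ K) (hr : 0 < r) (γ : ℝ) (m : ℕ) :
    (K / r ^ (m + 3)) ^ γ * (K / r ^ (m + 1)) ^ (1 - γ) = K * r ^ (-(m + 1 + 2 * γ)) := by
  obtain rfl | hK0 := hK.eq_or_lt
  · obtain rfl | hγ := eq_or_ne γ 0
    · simp
    · simp [Real.zero_rpow hγ]
  have hpow : ∀ n : ℕ, K / r ^ n = K * r ^ (-(n : ℝ)) := fun n => by
    rw [Real.rpow_neg hr.le, Real.rpow_natCast, div_eq_mul_inv]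
  rw [hpow, hpow, Real.mul_rpow hK (by positivity), Real.mul_rpow hK (by positivity),
    mul_mul_mul_comm, ← Real.rpow_add hK0, add_sub_cancel, Real.rpow_one, ← Real.rpow_mul hr.le,
    ← Real.rpow_mul hr.le, ← Real.rpow_add hr]
  push_cast
  ring_nf

lemma IsAdmissible.norm_modeSum_le {m : ℕ} {b C : ℝ} {Q : ℤ → V → F} (h : IsAdmissible m b C Q)
    {γ : ℝ} (hγ0 : 0 ≤ γ) (hγ1 : γ ≤ 1) {x : V} (hx : x ≠ 0) {t : AddCircle T}
    (ht : 0 < ‖fourier 1 t - 1‖) :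
    ‖modeSum Q t x‖ ≤ (64 * C / b ^ 2 + (16 / b + 2) * C) * ‖x‖ ^ (-(m + 1 + 2 * γ)) *
      Real.exp (-(b / 2 * ‖x‖)) * ‖fourier 1 t - 1‖ ^ (-(1 - γ)) := by
  have hb := h.rate_pos
  have hC := h.const_nonneg
  have hr : 0 < ‖x‖ := norm_pos_iff.2 hx
  set K : ℝ := 64 * C / b ^ 2 + (16 / b + 2) * C
  set E : ℝ := Real.exp (-(b / 2 * ‖x‖))
  have hsum : ∑' k, ‖Q k x‖ ≤ K / ‖x‖ ^ (m + 3) * E := by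
    refine (h.tsum_norm_le hx).trans ?_
    gcongr
    exact le_add_of_nonneg_right (by positivity)
  have hsum_sub : ∑' k, ‖Q k x - Q (k - 1) x‖ ≤ K / ‖x‖ ^ (m + 1) * E := by
    refine (h.tsum_norm_sub_le hx).trans ?_
    gcongr
    exact le_add_of_nonneg_left (by positivity)
  refine (norm_tsum_fourier_smul_le_interpolation (h.summable_norm hx) ht hγ0 hγ1
    hsum hsum_sub).trans_eq ?_
  have hE : E ^ γ * E ^ (1 - γ) = E := by
    rw [← Real.rpow_add (Real.exp_pos _), add_sub_cancel, Real.rpow_one]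
  rw [Real.mul_rpow (by positivity) (by positivity), Real.mul_rpow (by positivity) (by positivity),
    mul_mul_mul_comm, hE, rpow_mul_rpow_one_sub_div_pow (by positivity) hr]

variable [Fact (0 < T)]

lemma mul_abs_le_norm_fourier_one_sub_one {t : ℝ} (ht : |t| ≤ T / 2) :
    4 / T * |t| ≤ ‖fourier 1 (t : AddCircle T) - 1‖ := by
  have hT : 0 < T := Fact.out
  have hfourier : fourier 1 (t : AddCircle T) = cexp (I * ((2 * Real.pi * t / T : ℝ) : ℂ)) := by
    rw [fourier_coe_apply]
    push_cast
    ring_nf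
  have habs : |2 * Real.pi * t / T / 2| = Real.pi / T * |t| := by
    rw [show 2 * Real.pi * t / T / 2 = Real.pi / T * t by ring, abs_mul,
      abs_of_pos (by positivity)]
  have hsin := Real.mul_abs_le_abs_sin (x := 2 * Real.pi * t / T / 2) (by
    rw [habs]
    calc Real.pi / T * |t| ≤ Real.pi / T * (T / 2) := by gcongr
      _ = Real.pi / 2 := by field_simp)
  rw [habs] at hsin
  rw [hfourier, Complex.norm_exp_I_mul_ofReal_sub_one, Real.norm_eq_abs, abs_mul, abs_two]
  calc 4 / T * |t| = 2 * (2 / Real.pi * (Real.pi / T * |t|)) := by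
        field_simp
        ring
    _ ≤ _ := by gcongr

lemma ae_fourier_one_ne_one :
    ∀ᵐ t : AddCircle T ∂AddCircle.haarAddCircle, 0 < ‖fourier 1 t - 1‖ := by
  have hvol : (AddCircle.haarAddCircle (T := T)) {0} = 0 := by
    have h : (volume : Measure (AddCircle T)) {0} = 0 := by
      rw [← Metric.closedBall_zero, AddCircle.volume_closedBall]
      simp
    simpa [AddCircle.volume_eq_smul_haarAddCircle, (Fact.out : 0 < T).not_ge] using h
  have hne : ∀ᵐ t : AddCircle T ∂AddCircle.haarAddCircle, t ≠ 0 := by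
    rwa [ae_iff, show {t : AddCircle T | ¬t ≠ 0} = {0} by ext; simp]
  filter_upwards [hne] with t ht
  rw [norm_pos_iff, sub_ne_zero, fourier_one]
  intro h
  refine ht (AddCircle.injective_toCircle (Fact.out : 0 < T).ne' ?_)
  rw [AddCircle.toCircle_zero]
  exact Circle.ext h

lemma norm_fourier_one_sub_one_rpow_neg_le {p : ℝ} (hp : 0 ≤ p) {t : ℝ} (ht0 : t ≠ 0)
    (ht : |t| ≤ T / 2) :
    ‖fourier 1 (t : AddCircle T) - 1‖ ^ (-p) ≤
      (4 / T) ^ (-p) * Real.exp T * (‖t‖ ^ (-p) * Real.exp (-(1 * ‖t‖))) := by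
  have hT : 0 < T := Fact.out
  have hpos : 0 < |t| := abs_pos.2 ht0
  have hone : 1 ≤ Real.exp T * Real.exp (-(1 * |t|)) := by
    rw [← Real.exp_add]
    exact Real.one_le_exp (by linarith)
  calc _ ≤ (4 / T * |t|) ^ (-p) :=
        Real.rpow_le_rpow_of_nonpos (by positivity) (mul_abs_le_norm_fourier_one_sub_one ht)
          (by linarith)
    _ = (4 / T) ^ (-p) * |t| ^ (-p) := Real.mul_rpow (by positivity) (by positivity)
    _ ≤ (4 / T) ^ (-p) * |t| ^ (-p) * (Real.exp T * Real.exp (-(1 * |t|))) :=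
        le_mul_of_one_le_right (by positivity) hone
    _ = _ := by
        rw [Real.norm_eq_abs]
        ring

lemma eLpNorm_norm_fourier_one_sub_one_rpow_lt_top {s q : ℝ} (hs : 0 ≤ s) (hq : 0 < q)
    (hsq : s * q < 1) :
    eLpNorm (fun t : AddCircle T => ‖fourier 1 t - 1‖ ^ (-s)) (ENNReal.ofReal q)
      AddCircle.haarAddCircle < ⊤ := by
  have hT : 0 < T := Fact.out
  rw [eLpNorm_lt_top_iff_lintegral_rpow_enorm_lt_top (by simpa using hq) ENNReal.ofReal_ne_top,
    ENNReal.toReal_ofReal hq.le]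
  have hmajorant := (integrable_norm_rpow_mul_exp (volume : Measure ℝ) (s := s * q) (c := 1)
    (by simpa using hsq) one_pos).const_mul ((4 / T) ^ (-(s * q)) * Real.exp T)
  have hvol : ∫⁻ t : AddCircle T, ‖‖fourier 1 t - 1‖ ^ (-s)‖ₑ ^ q < ⊤ := by
    rw [← AddCircle.lintegral_preimage T (-(T / 2))]
    refine lt_of_le_of_lt ?_ hmajorant.lintegral_lt_top
    refine (lintegral_mono_ae ?_).trans (setLIntegral_le_lintegral (Ioc (-(T / 2)) _) _)
    filter_upwards [ae_restrict_mem measurableSet_Ioc,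
      ae_restrict_of_ae (Measure.ae_ne volume (0 : ℝ))] with t ht ht0
    rw [← ofReal_norm, Real.norm_of_nonneg (by positivity),
      ENNReal.ofReal_rpow_of_nonneg (by positivity) hq.le, ← Real.rpow_mul (norm_nonneg _), neg_mul]
    exact ENNReal.ofReal_le_ofReal (norm_fourier_one_sub_one_rpow_neg_le (by positivity) ht0
      (abs_le.2 ⟨by linarith [ht.1], by linarith [ht.2]⟩))
  rw [AddCircle.volume_eq_smul_haarAddCircle, lintegral_smul_measure, smul_eq_mul] at hvol
  exact ENNReal.lt_top_of_mul_ne_top_right hvol.ne (by simpa using hT)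

lemma IsAdmissible.exists_eLpNorm_modeSum_le {m : ℕ} {b C : ℝ} {Q : ℤ → V → F}
    (h : IsAdmissible m b C Q) {γ q : ℝ} (hγ0 : 0 ≤ γ) (hγ1 : γ < 1) (hq0 : 0 < q)
    (hq : q < 1 / (1 - γ)) :
    ∃ K > 0, ∀ x, x ≠ 0 →
      eLpNorm (fun t : AddCircle T => modeSum Q t x) (ENNReal.ofReal q) AddCircle.haarAddCircle ≤
        ENNReal.ofReal (K * ‖x‖ ^ (-(m + 1 + 2 * γ)) * Real.exp (-(b / 2 * ‖x‖))) := by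
  have hb := h.rate_pos
  have hC := h.const_nonneg
  have hγ : 0 < 1 - γ := sub_pos.2 hγ1
  set w := eLpNorm (fun t : AddCircle T => ‖fourier 1 t - 1‖ ^ (-(1 - γ))) (ENNReal.ofReal q)
    AddCircle.haarAddCircle
  have hw : w < ⊤ := eLpNorm_norm_fourier_one_sub_one_rpow_lt_top hγ.le hq0 <| by
    rwa [lt_div_iff₀ hγ, mul_comm] at hq
  set K := 64 * C / b ^ 2 + (16 / b + 2) * C
  have hK : 0 ≤ K := by positivity
  refine ⟨(K + 1) * (w.toReal + 1), by positivity, fun x hx => ?_⟩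
  have hr : 0 < ‖x‖ := norm_pos_iff.2 hx
  set D := ‖x‖ ^ (-(m + 1 + 2 * γ)) * Real.exp (-(b / 2 * ‖x‖))
  have hD : 0 ≤ D := by positivity
  calc _ ≤ ENNReal.ofReal (K * D) * w := by
        refine eLpNorm_le_mul_eLpNorm_of_ae_le_mul ?_ _
        filter_upwards [ae_fourier_one_ne_one] with t ht
        rw [Real.norm_of_nonneg (by positivity), ← mul_assoc]
        exact h.norm_modeSum_le hγ0 hγ1.le hx ht
    _ = ENNReal.ofReal (K * D * w.toReal) := by
        rw [ENNReal.ofReal_mul (p := K * D) (by positivity), ENNReal.ofReal_toReal hw.ne]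
    _ ≤ _ := by
        refine ENNReal.ofReal_le_ofReal ?_
        calc K * D * w.toReal ≤ (K + 1) * D * (w.toReal + 1) := by
              gcongr <;> linarith
          _ = _ := by ring

end Circle

section ModeSum

variable {T : ℝ} {V F : Type*} [NormedAddCommGroup V] [NormedAddCommGroup F]
variable {m n : ℕ} {b b' C C' : ℝ} {Q : ℤ → V → F}

namespace IsAdmissible

lemma exists_summable_bound (h : IsAdmissible m b C Q) {r : ℝ} (hr : 0 < r) :
    ∃ u : ℤ → ℝ, Summable u ∧ ∀ k x, r ≤ ‖x‖ → ‖Q k x‖ ≤ u k :=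
  have hb := h.rate_pos
  ⟨_, ((summable_sqrtWeight (by positivity)).mul_left _).mul_left _,
    fun k _ hx => h.norm_le_sqrtWeight hr hx k⟩

lemma continuousLinearMap_apply [NormedSpace ℝ V] [NormedSpace ℝ F] {Q' : ℤ → V → V →L[ℝ] F}
    (h : IsAdmissible m b C Q') {v : V} (hv : ‖v‖ ≤ 1) :
    IsAdmissible m b C fun k x => Q' k x v where
  rate_pos := h.rate_pos
  const_nonneg := h.const_nonneg
  zero := by
    rw [h.zero]
    rfl
  continuousOn k := (h.continuousOn k).clm_apply continuousOn_const
  norm_le k hk x hx := ((Q' k x).unit_le_opNorm v hv).trans (h.norm_le k hk x hx)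
  norm_sub_le k hk hk1 x hx :=
    ((Q' k x - Q' (k - 1) x).unit_le_opNorm v hv).trans (h.norm_sub_le k hk hk1 x hx)

variable [NormedSpace ℂ F] [CompleteSpace F]

lemma continuousOn_modeSum (h : IsAdmissible m b C Q) :
    ContinuousOn (fun z : AddCircle T × V => modeSum Q z.1 z.2) {z | z.2 ≠ 0} := by
  refine continuousOn_of_forall_continuousAt fun z hz => ?_
  have hr : 0 < ‖z.2‖ / 2 := half_pos (norm_pos_iff.2 hz)
  obtain ⟨u, hu, hle⟩ := h.exists_summable_bound hr
  have hopen : IsOpen {y : AddCircle T × V | ‖z.2‖ / 2 < ‖y.2‖} :=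
    isOpen_lt continuous_const continuous_snd.norm
  have hcont : ContinuousOn (fun y : AddCircle T × V => modeSum Q y.1 y.2)
      {y | ‖z.2‖ / 2 < ‖y.2‖} := by
    refine continuousOn_tsum (fun k => ?_) hu fun k y hy => ?_
    · exact ((map_continuous (fourier k)).comp continuous_fst).continuousOn.smul
        ((h.continuousOn k).comp continuousOn_snd fun y hy => norm_pos_iff.1 (hr.trans hy))
    · rw [norm_fourier_smul]
      exact hle k y.2 (le_of_lt hy)
  exact hcont.continuousAt (hopen.mem_nhds (half_lt_self (norm_pos_iff.2 hz)))

lemma hasFDerivAt_modeSum [NormedSpace ℝ V] [NormedSpace ℝ F] [SMulCommClass ℝ ℂ F]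
    {Q' : ℤ → V → V →L[ℝ] F} (h : IsAdmissible m b C Q) (h' : IsAdmissible n b' C' Q')
    (hQ : ∀ k x, x ≠ 0 → HasFDerivAt (Q k) (Q' k x) x) (t : AddCircle T) {x : V} (hx : x ≠ 0) :
    HasFDerivAt (modeSum Q t) (modeSum Q' t x) x := by
  have hr : 0 < ‖x‖ / 2 := half_pos (norm_pos_iff.2 hx)
  obtain ⟨u, hu, hle⟩ := h'.exists_summable_bound hr
  have hball : ∀ y ∈ Metric.ball x (‖x‖ / 2), ‖x‖ / 2 ≤ ‖y‖ := fun y hy => by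
    rw [mem_ball_iff_norm'] at hy
    linarith [norm_le_norm_add_norm_sub' x y]
  have hderiv : ∀ k, ∀ y ∈ Metric.ball x (‖x‖ / 2), HasFDerivAt
      (fun y => (fourier k t : ℂ) • Q k y) ((fourier k t : ℂ) • Q' k y) y := fun k y hy =>
    (hQ k y (norm_pos_iff.1 (hr.trans_le (hball y hy)))).const_smul (fourier k t : ℂ)
  have hbound : ∀ k, ∀ y ∈ Metric.ball x (‖x‖ / 2), ‖(fourier k t : ℂ) • Q' k y‖ ≤ u k :=
    fun k y hy => (norm_fourier_smul k t (Q' k y)).trans_le (hle k y (hball y hy))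
  exact hasFDerivAt_tsum_of_isPreconnected hu Metric.isOpen_ball
    (convex_ball x (‖x‖ / 2)).isPreconnected hderiv hbound (Metric.mem_ball_self hr)
    (summable_fourier_smul (h.summable_norm hx) t) (Metric.mem_ball_self hr)

end IsAdmissible

end ModeSum

section Gradient

variable {T : ℝ}

lemma norm_gradx_le (φ : AddCircle T → E3 → ℂ) (t : AddCircle T) (x : E3) :
    ‖gradx φ t x‖ ≤ 3 * ‖fderiv ℝ (φ t) x‖ := by
  have hpdx : ∀ j, ‖pdx j φ t x‖ ≤ ‖fderiv ℝ (φ t) x‖ := fun j =>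
    (fderiv ℝ (φ t) x).unit_le_opNorm _ (by simp)
  rw [gradx, EuclideanSpace.norm_eq, Real.sqrt_le_left (by positivity), mul_pow]
  calc ∑ j, ‖pdx j φ t x‖ ^ 2 ≤ ∑ _j : Fin 3, ‖fderiv ℝ (φ t) x‖ ^ 2 := by
        gcongr with j
        exact hpdx j
    _ ≤ _ := by
        rw [Fin.sum_const, nsmul_eq_mul]
        gcongr
        norm_num

end Gradient

section FourierCoeff

variable {T : ℝ} [hT : Fact (0 < T)]

lemma fourierCoeff_eq_mul_fourierCoeff_deriv {f f' : AddCircle T → ℂ}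
    (hf : ∀ s : ℝ, HasDerivAt (fun s : ℝ => f s) (f' s) s) (hf' : Continuous f') {k : ℤ}
    (hk : k ≠ 0) : fourierCoeff f k = T / (2 * Real.pi * I * k) * fourierCoeff f' k := by
  have hcoe : ∀ g : AddCircle T → ℂ,
      fourierCoeffOn (lt_add_of_pos_right 0 hT.out) (fun s : ℝ => g s) k = fourierCoeff g k := by
    intro g
    rw [← fourierCoeff_liftIco_eq]
    congr 1
    ext t
    exact congrArg g (AddCircle.coe_equivIco (a := (0 : ℝ)) (p := T))
  have h := fourierCoeffOn_of_hasDerivAt (lt_add_of_pos_right 0 hT.out) hk (fun s _ => hf s)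
    ((hf'.comp (AddCircle.continuous_mk' T)).intervalIntegrable _ _)
  have hper : f ((0 + T : ℝ) : AddCircle T) = f ((0 : ℝ) : AddCircle T) := by
    rw [AddCircle.coe_add_period]
  rw [hcoe, hcoe, hper, sub_self, mul_zero, zero_sub, ofReal_add, ofReal_zero, zero_add,
    sub_zero] at h
  rw [h]
  field_simp

lemma norm_fourierCoeff_le (f : AddCircle T → ℂ) {B : ℝ} (hB : ∀ t, ‖f t‖ ≤ B) (k : ℤ) :
    ‖fourierCoeff f k‖ ≤ B := by
  simpa only [fourierCoeff, probReal_univ, mul_one] using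
    norm_integral_le_of_norm_le_const (μ := AddCircle.haarAddCircle)
      (Eventually.of_forall fun t => (norm_fourier_smul (-k) t (f t)).trans_le (hB t))

lemma norm_fourierCoeff_le_mul_pow {k : ℤ} (hk : k ≠ 0) {D : ℝ} (n : ℕ) :
    ∀ {f : AddCircle T → ℂ}, ContDiff ℝ n (fun s : ℝ => f s) →
      (∀ s, ‖iteratedDeriv n (fun s : ℝ => f s) s‖ ≤ D) →
      ‖fourierCoeff f k‖ ≤ (T / (2 * Real.pi * |(k : ℝ)|)) ^ n * D := by
  induction n with
  | zero =>
    intro f _ hD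
    rw [pow_zero, one_mul]
    refine norm_fourierCoeff_le f (fun t => ?_) k
    obtain ⟨s, rfl⟩ := QuotientAddGroup.mk_surjective t
    simpa using hD s
  | succ n ih =>
    intro f hf hD
    have hper : Function.Periodic (deriv fun s : ℝ => f s) T := fun s => by
      rw [← deriv_comp_add_const]
      simp only [AddCircle.coe_add_period]
    have hf1 : ContDiff ℝ (n + 1) fun s : ℝ => f s := by exact_mod_cast hf
    have hderiv := (contDiff_succ_iff_deriv.1 hf1).2.2
    have hcont : Continuous hper.lift :=
      continuous_coinduced_dom.2 hderiv.continuous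
    rw [fourierCoeff_eq_mul_fourierCoeff_deriv (f' := hper.lift)
      (fun s => (hf1.differentiable (by simp) s).hasDerivAt) hcont hk, norm_mul, pow_succ',
      mul_assoc _ _ D]
    refine mul_le_mul (le_of_eq ?_)
      (ih (f := hper.lift) hderiv fun s => by simpa only [iteratedDeriv_succ'] using! hD s)
      (norm_nonneg _) (by have := hT.out; positivity)
    rw [norm_div, norm_real, Real.norm_of_nonneg hT.out.le]
    simp [abs_of_pos Real.pi_pos]

end FourierCoeff

section Slice

variable {E F G : Type*} [NormedAddCommGroup E] [NormedSpace ℝ E] [NormedAddCommGroup F]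
  [NormedSpace ℝ F] [NormedAddCommGroup G] [NormedSpace ℝ G]

lemma norm_iteratedFDeriv_comp_add_le {f : F → G} {n : ℕ} (hf : ContDiff ℝ n f) {L : E →L[ℝ] F}
    (hL : ‖L‖ ≤ 1) (c : F) (x : E) :
    ‖iteratedFDeriv ℝ n (fun y => f (L y + c)) x‖ ≤ ‖iteratedFDeriv ℝ n f (L x + c)‖ := by
  have h := L.iteratedFDeriv_comp_right (f := fun z => f (z + c)) (by fun_prop) x le_rfl
  rw [Function.comp_def] at h
  rw [h, iteratedFDeriv_comp_add_right]
  refine (ContinuousMultilinearMap.norm_compContinuousLinearMap_le _ _).trans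
    (mul_le_of_le_one_right (norm_nonneg _) ?_)
  exact Finset.prod_le_one (fun _ _ => norm_nonneg _) fun _ _ => hL

end Slice

section SchwartzBruhat

open scoped SchwartzMap

namespace IsSchwartzBruhat

variable {T : ℝ} {ψ : AddCircle T → E3 → ℂ}

lemma continuous (h : IsSchwartzBruhat T ψ) :
    Continuous fun z : AddCircle T × E3 => ψ z.1 z.2 :=
  (QuotientAddGroup.isOpenQuotientMap_mk.prodMap IsOpenQuotientMap.id).continuous_comp_iff.1
    h.1.continuous

lemma contDiff_space (h : IsSchwartzBruhat T ψ) (t : AddCircle T) : ContDiff ℝ ∞ (ψ t) := by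
  obtain ⟨s, rfl⟩ := QuotientAddGroup.mk_surjective t
  exact h.1.comp (contDiff_const.prodMk contDiff_id : ContDiff ℝ ∞ fun x : E3 => (s, x))

lemma contDiff_time (h : IsSchwartzBruhat T ψ) (x : E3) :
    ContDiff ℝ ∞ fun s : ℝ => ψ (s : AddCircle T) x :=
  h.1.comp (contDiff_id.prodMk contDiff_const : ContDiff ℝ ∞ fun s : ℝ => (s, x))

lemma exists_space_decay (h : IsSchwartzBruhat T ψ) (k n : ℕ) :
    ∃ C, ∀ t x, ‖x‖ ^ k * ‖iteratedFDeriv ℝ n (ψ t) x‖ ≤ C := by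
  obtain ⟨C, hC⟩ := h.2 k n
  refine ⟨C, fun t x => ?_⟩
  obtain ⟨s, rfl⟩ := QuotientAddGroup.mk_surjective t
  have hslice := norm_iteratedFDeriv_comp_add_le (n := n) (h.1.of_le (by exact_mod_cast le_top))
    (ContinuousLinearMap.norm_inr_le_one ℝ ℝ E3) (s, 0) x
  simp only [ContinuousLinearMap.inr_apply, Prod.mk_add_mk, zero_add, add_zero] at hslice
  exact (mul_le_mul_of_nonneg_left hslice (by positivity)).trans (hC (s, x))

lemma exists_norm_iteratedDeriv_time_le (h : IsSchwartzBruhat T ψ) (n : ℕ) :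
    ∃ C, ∀ x s, ‖iteratedDeriv n (fun s : ℝ => ψ (s : AddCircle T) x) s‖ ≤ C := by
  obtain ⟨C, hC⟩ := h.2 0 n
  refine ⟨C, fun x s => ?_⟩
  have hslice := norm_iteratedFDeriv_comp_add_le (n := n) (h.1.of_le (by exact_mod_cast le_top))
    (ContinuousLinearMap.norm_inl_le_one ℝ ℝ E3) (0, x) s
  simp only [ContinuousLinearMap.inl_apply, Prod.mk_add_mk, zero_add, add_zero] at hslice
  rw [← norm_iteratedFDeriv_eq_norm_iteratedDeriv]
  simpa using! hslice.trans (by simpa using hC (s, x))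

lemma exists_norm_le (h : IsSchwartzBruhat T ψ) : ∃ B, ∀ t x, ‖ψ t x‖ ≤ B := by
  simpa using h.exists_space_decay 0 0

/-- The time slice `ψ(t, ·)` of a Schwartz–Bruhat function, as a Schwartz function on `ℝ³`. -/
def timeSlice (h : IsSchwartzBruhat T ψ) (t : AddCircle T) : 𝓢(E3, ℂ) where
  toFun := ψ t
  smooth' := h.contDiff_space t
  decay' k n := (h.exists_space_decay k n).imp fun _ hC => hC t

lemma coe_timeSlice (h : IsSchwartzBruhat T ψ) (t : AddCircle T) : ⇑(h.timeSlice t) = ψ t := rfl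

lemma isVonNBounded_range_timeSlice (h : IsSchwartzBruhat T ψ) :
    Bornology.IsVonNBounded ℂ (range h.timeSlice) := by
  rw [(schwartz_withSeminorms ℂ E3 ℂ).isVonNBounded_iff_seminorm_bounded]
  rintro ⟨k, n⟩
  obtain ⟨C, hC⟩ := h.exists_space_decay k n
  have hC0 : 0 ≤ C := le_trans (by positivity) (hC 0 0)
  have hle : ∀ t, SchwartzMap.seminorm ℂ k n (h.timeSlice t) ≤ C := fun t =>
    SchwartzMap.seminorm_le_bound ℂ k n _ hC0 (hC t)
  exact ⟨C + 1, by positivity, forall_mem_range.2 fun t => (hle t).trans_lt (lt_add_one C)⟩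

lemma pdx (h : IsSchwartzBruhat T ψ) (j : Fin 3) : IsSchwartzBruhat T (pdx j ψ) := by
  set A : (ℝ × E3 →L[ℝ] ℂ) →L[ℝ] ℂ :=
    ContinuousLinearMap.apply ℝ ℂ ((0, EuclideanSpace.single j 1) : ℝ × E3)
  have hfun : lift T (TimePeriodic.pdx j ψ) = A ∘ fderiv ℝ (lift T ψ) := by
    ext z
    have hslice : HasFDerivAt (ψ (z.1 : AddCircle T))
        ((fderiv ℝ (lift T ψ) z).comp (ContinuousLinearMap.inr ℝ ℝ E3)) z.2 :=
      HasFDerivAt.comp (g := lift T ψ) (f := fun x : E3 => (z.1, x)) z.2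
        (h.1.differentiable (by simp) z).hasFDerivAt (hasFDerivAt_prodMk_right z.1 z.2)
    rw [lift, TimePeriodic.pdx, hslice.fderiv]
    rfl
  have hfderiv : ContDiff ℝ ∞ (fderiv ℝ (lift T ψ)) := h.1.fderiv_right (by simp)
  rw [IsSchwartzBruhat, hfun]
  refine ⟨A.contDiff.comp hfderiv, fun k n => ?_⟩
  obtain ⟨C, hC⟩ := h.2 k (n + 1)
  refine ⟨‖A‖ * C, fun z => ?_⟩
  have hle := A.norm_iteratedFDeriv_comp_left (x := z) hfderiv.contDiffAt (n := n)
    (by exact_mod_cast le_top)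
  rw [norm_iteratedFDeriv_fderiv] at hle
  calc _ ≤ ‖z.2‖ ^ k * (‖A‖ * ‖iteratedFDeriv ℝ (n + 1) (lift T ψ) z‖) := by gcongr
    _ = ‖A‖ * (‖z.2‖ ^ k * ‖iteratedFDeriv ℝ (n + 1) (lift T ψ) z‖) := by ring
    _ ≤ _ := by gcongr; exact hC z

end IsSchwartzBruhat

lemma exists_forall_norm_le_of_isVonNBounded {E F : Type*} [NormedAddCommGroup E]
    [NormedSpace ℝ E] [NormedAddCommGroup F] [NormedSpace ℝ F] [NormedSpace ℂ F]
    [SMulCommClass ℝ ℂ F] {S : Set 𝓢(E, F)} (hS : Bornology.IsVonNBounded ℂ S) (n : ℕ) :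
    ∃ D, ∀ g ∈ S, ∀ x, ‖g x‖ ≤ D * (1 + ‖x‖) ^ (-(n : ℝ)) := by
  obtain ⟨r, -, hr⟩ := (schwartz_withSeminorms ℂ E F).isVonNBounded_iff_finset_seminorm_bounded.1
    hS (Finset.Iic (n, 0))
  refine ⟨2 ^ n * r, fun g hg x => ?_⟩
  have hle := SchwartzMap.one_add_le_sup_seminorm_apply (𝕜 := ℂ) (m := (n, 0)) le_rfl le_rfl g x
  rw [norm_iteratedFDeriv_zero] at hle
  rw [Real.rpow_neg (by positivity), Real.rpow_natCast, ← div_eq_mul_inv,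
    le_div_iff₀ (by positivity), mul_comm]
  exact hle.trans (mul_le_mul_of_nonneg_left (hr g hg).le (by positivity))

end SchwartzBruhat

section FourierDuality

open scoped FourierTransform

variable {V : Type*} [NormedAddCommGroup V] [InnerProductSpace ℝ V] [FiniteDimensional ℝ V]
  [MeasurableSpace V] [BorelSpace V]

lemma integral_fourier_mul_fourierInv {P g : V → ℂ} (hP : Integrable P) (hg : Integrable g)
    (hgc : Continuous g) (hg' : Integrable (𝓕⁻ g)) :
    ∫ w, 𝓕 P w * 𝓕⁻ g w = ∫ x, P x * g x := by
  have hflip : ∫ w, 𝓕 P w • 𝓕⁻ g w = ∫ x, P x • 𝓕 (𝓕⁻ g) x := by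
    simpa using! VectorFourier.integral_fourierIntegral_smul_eq_flip (L := innerₗ V)
      Real.continuous_fourierChar continuous_inner hP hg'
  have hFg : Integrable (𝓕 g) := by
    simpa only [Real.fourierInv_eq_fourier_neg, neg_neg] using hg'.comp_neg
  simpa only [hgc.fourier_fourierInv_eq hg hFg, smul_eq_mul] using hflip

lemma integral_mul_cexp_neg_eq_fourier (P : V → ℂ) (ξ : V) :
    ∫ x, P x * cexp (-(I * (⟪x, ξ⟫ : ℝ))) = 𝓕 P ((2 * Real.pi)⁻¹ • ξ) := by
  rw [Real.fourier_eq']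
  congr! 2 with x
  rw [smul_eq_mul, mul_comm, inner_smul_right]
  push_cast
  have : (Real.pi : ℂ) ≠ 0 := ofReal_ne_zero.2 Real.pi_ne_zero
  congr 2
  field_simp

lemma integral_mul_cexp_eq_fourierInv (P : V → ℂ) (ξ : V) :
    ∫ x, P x * cexp (I * (⟪x, ξ⟫ : ℝ)) = 𝓕⁻ P ((2 * Real.pi)⁻¹ • ξ) := by
  simp only [Real.fourierInv_eq_fourier_neg, ← smul_neg, ← integral_mul_cexp_neg_eq_fourier,
    inner_neg_right, ofReal_neg, mul_neg, neg_neg]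

lemma inv_two_pi_pow_mul_integral_mul_fourierInv {P g : V → ℂ} (hP : Integrable P)
    (hg : Integrable g) (hgc : Continuous g) (hg' : Integrable (𝓕⁻ g)) :
    ((2 * Real.pi : ℝ) ^ Module.finrank ℝ V : ℂ)⁻¹ *
        ∫ ξ, (∫ x, P x * cexp (-(I * (⟪x, ξ⟫ : ℝ)))) * 𝓕⁻ g ((2 * Real.pi)⁻¹ • ξ) =
      ∫ x, P x * g x := by
  have hpos : 0 < 2 * Real.pi := Real.two_pi_pos
  simp only [integral_mul_cexp_neg_eq_fourier]
  rw [Measure.integral_comp_inv_smul volume (fun w => 𝓕 P w * 𝓕⁻ g w),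
    integral_fourier_mul_fourierInv hP hg hgc hg', abs_of_pos (by positivity), real_smul,
    ofReal_pow, inv_mul_cancel_left₀ (pow_ne_zero _ (ofReal_ne_zero.2 hpos.ne'))]

end FourierDuality

section TimeMode

open scoped FourierTransform SchwartzMap

variable {T : ℝ} [hT : Fact (0 < T)] {V : Type*}

/-- The `k`-th time mode `x ↦ ∫ e_k(t) ψ(t, x) dt` of a function on `𝕋 × V`. It is paired with
the `k`-th term of a mode series, hence the Fourier coefficient of index `-k`. -/
def timeMode (ψ : AddCircle T → V → ℂ) (k : ℤ) (x : V) : ℂ := fourierCoeff (fun t => ψ t x) (-k)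

lemma timeMode_eq_integral (ψ : AddCircle T → V → ℂ) (k : ℤ) (x : V) :
    timeMode ψ k x = ∫ t, fourier k t * ψ t x ∂AddCircle.haarAddCircle := by
  simp only [timeMode, fourierCoeff, neg_neg, smul_eq_mul]

lemma integral_fourier_mul_mul [MeasurableSpace V] {μ : Measure V} [SFinite μ]
    {ψ : AddCircle T → V → ℂ} {k : ℤ} {g : V → ℂ}
    (hint : Integrable (fun z : AddCircle T × V => fourier k z.1 * ψ z.1 z.2 * g z.2)
      (AddCircle.haarAddCircle.prod μ)) :
    ∫ z, fourier k z.1 * ψ z.1 z.2 * g z.2 ∂(AddCircle.haarAddCircle (T := T)).prod μ =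
      ∫ x, timeMode ψ k x * g x ∂μ := by
  rw [integral_prod_symm _ hint]
  simp only [integral_mul_const, timeMode_eq_integral]

namespace IsSchwartzBruhat

variable {ψ : AddCircle T → E3 → ℂ}

lemma exists_summable_norm_timeMode_le (h : IsSchwartzBruhat T ψ) :
    ∃ u : ℤ → ℝ, Summable u ∧ ∀ k x, ‖timeMode ψ k x‖ ≤ u k := by
  obtain ⟨B, hB⟩ := h.exists_norm_le
  obtain ⟨D, hD⟩ := h.exists_norm_iteratedDeriv_time_le 2
  have hsum : Summable fun k : ℤ => (T / (2 * Real.pi * |(k : ℝ)|)) ^ 2 * D := by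
    refine Summable.mul_right D (((Real.summable_one_div_int_pow.2 one_lt_two).mul_left
      ((T / (2 * Real.pi)) ^ 2)).congr fun k => ?_)
    rw [← sq_abs (k : ℝ)]
    field_simp
  refine ⟨Function.update _ 0 B, hsum.update 0 B, fun k x => ?_⟩
  obtain rfl | hk := eq_or_ne k 0
  · simpa only [Function.update_self] using! norm_fourierCoeff_le _ (fun t => hB t x) _
  · have hle := norm_fourierCoeff_le_mul_pow (neg_ne_zero.2 hk) 2 (f := fun t => ψ t x)
      (contDiff_infty.1 (h.contDiff_time x) 2) (hD x)
    rw [Function.update_of_ne hk]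
    simpa only [Int.cast_neg, abs_neg] using! hle

lemma continuous_timeMode (h : IsSchwartzBruhat T ψ) (k : ℤ) : Continuous (timeMode ψ k) := by
  obtain ⟨B, hB⟩ := h.exists_norm_le
  have hψ := h.continuous
  rw [funext (timeMode_eq_integral ψ k)]
  refine continuous_of_dominated (bound := fun _ => B) (fun x => ?_) (fun x => ?_)
    (integrable_const B) (Eventually.of_forall fun t => ?_)
  · exact Continuous.aestronglyMeasurable (by fun_prop)
  · refine Eventually.of_forall fun t => ?_
    rw [norm_mul, norm_fourier_apply, one_mul]
    exact hB t x
  · fun_prop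

lemma integrable (h : IsSchwartzBruhat T ψ) :
    Integrable (fun z : AddCircle T × E3 => ψ z.1 z.2) (haarG T) := by
  obtain ⟨D, hD⟩ := exists_forall_norm_le_of_isVonNBounded h.isVonNBounded_range_timeSlice 4
  have hint := (integrable_one_add_norm (E := E3) (μ := volume) (r := (4 : ℕ))
    (by rw [finrank_euclideanSpace_fin]; norm_num)).comp_snd (AddCircle.haarAddCircle (T := T))
  exact (hint.const_mul D).mono' h.continuous.aestronglyMeasurable
    (Eventually.of_forall fun z => hD _ (mem_range_self z.1) z.2)

lemma integrable_fourier_mul (h : IsSchwartzBruhat T ψ) (k : ℤ) :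
    Integrable (fun z : AddCircle T × E3 => fourier k z.1 * ψ z.1 z.2) (haarG T) :=
  h.integrable.bdd_mul (c := 1) (Continuous.aestronglyMeasurable (by fun_prop))
    (Eventually.of_forall fun z => (norm_fourier_apply k z.1).le)

lemma integrable_timeMode (h : IsSchwartzBruhat T ψ) (k : ℤ) : Integrable (timeMode ψ k) := by
  rw [funext (timeMode_eq_integral ψ k)]
  exact (h.integrable_fourier_mul k).integral_prod_right

lemma integrable_fourier_mul_mul (h : IsSchwartzBruhat T ψ) (k : ℤ) {g : E3 → ℂ} {c : ℝ}
    (hg : Continuous g) (hc : ∀ x, ‖g x‖ ≤ c) :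
    Integrable (fun z : AddCircle T × E3 => fourier k z.1 * ψ z.1 z.2 * g z.2) (haarG T) :=
  (h.integrable_fourier_mul k).mul_bdd (c := c) (Continuous.aestronglyMeasurable (by fun_prop))
    (Eventually.of_forall fun z => hc z.2)

lemma fourierG_neg_neg (h : IsSchwartzBruhat T ψ) (k : ℤ) (ξ : E3) :
    fourierG T ψ (-k) (-ξ) = 𝓕⁻ (timeMode ψ k) ((2 * Real.pi)⁻¹ • ξ) := by
  rw [← integral_mul_cexp_eq_fourierInv, ← integral_fourier_mul_mul
    (h.integrable_fourier_mul_mul k (g := fun x => cexp (I * (⟪x, ξ⟫ : ℝ))) (c := 1)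
      (by fun_prop) fun x => by simp [Complex.norm_exp])]
  simp only [fourierG, neg_neg, inner_neg_right, ofReal_neg, mul_neg]
  exact integral_congr_ae (Eventually.of_forall fun z => by ring)

lemma fourierInv_timeMode (h : IsSchwartzBruhat T ψ) (k : ℤ) (w : E3) :
    𝓕⁻ (timeMode ψ k) w = timeMode (fun t => 𝓕⁻ (ψ t)) k w := by
  have hint := h.integrable_fourier_mul_mul k (g := fun x => cexp ((2 * Real.pi * ⟪x, w⟫ : ℝ) * I))
    (c := 1) (by fun_prop) fun x => (norm_exp_ofReal_mul_I _).le
  calc 𝓕⁻ (timeMode ψ k) w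
      = ∫ x, timeMode ψ k x * cexp ((2 * Real.pi * ⟪x, w⟫ : ℝ) * I) := by
        simp only [Real.fourierInv_eq', smul_eq_mul, mul_comm]
    _ = ∫ t, (∫ x, fourier k t * ψ t x * cexp ((2 * Real.pi * ⟪x, w⟫ : ℝ) * I))
          ∂AddCircle.haarAddCircle := by
        rw [← integral_fourier_mul_mul hint]
        exact integral_prod _ hint
    _ = timeMode (fun t => 𝓕⁻ (ψ t)) k w := by
        simp only [timeMode_eq_integral, Real.fourierInv_eq', mul_assoc, integral_const_mul,
          smul_eq_mul, mul_comm (ψ _ _)]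

lemma integrable_fourierInv_timeMode (h : IsSchwartzBruhat T ψ) (k : ℤ) :
    Integrable (𝓕⁻ (timeMode ψ k)) := by
  obtain ⟨D, hD⟩ := exists_forall_norm_le_of_isVonNBounded (h.isVonNBounded_range_timeSlice.image
    (FourierTransform.fourierInvCLM ℂ 𝓢(E3, ℂ))) 4
  have hslice : ∀ t w, ‖𝓕⁻ (ψ t) w‖ ≤ D * (1 + ‖w‖) ^ (-((4 : ℕ) : ℝ)) := by
    intro t w
    rw [← h.coe_timeSlice, ← SchwartzMap.fourierInv_coe]
    exact hD _ (mem_image_of_mem _ (mem_range_self t)) w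
  refine ((integrable_one_add_norm (E := E3) (μ := volume) (r := (4 : ℕ))
    (by rw [finrank_euclideanSpace_fin]; norm_num)).const_mul D).mono' ?_
      (Eventually.of_forall fun w => ?_)
  · rw [Real.fourierInv_eq_fourier_comp_neg]
    exact (VectorFourier.fourierIntegral_continuous Real.continuous_fourierChar
      (innerSL ℝ).continuous₂ (h.integrable_timeMode k).comp_neg).aestronglyMeasurable
  · rw [h.fourierInv_timeMode]
    exact norm_fourierCoeff_le _ (fun t => hslice t w) _

lemma inv_mul_integral_mul_fourierG (h : IsSchwartzBruhat T ψ) (k : ℤ) {P : E3 → ℂ}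
    (hP : Integrable P) :
    ((2 * Real.pi : ℝ) ^ 3 : ℂ)⁻¹ *
        ∫ ξ, (∫ x, P x * cexp (-(I * (⟪x, ξ⟫ : ℝ)))) * fourierG T ψ (-k) (-ξ) =
      ∫ x, P x * timeMode ψ k x := by
  rw [← inv_two_pi_pow_mul_integral_mul_fourierInv hP (h.integrable_timeMode k)
    (h.continuous_timeMode k) (h.integrable_fourierInv_timeMode k), finrank_euclideanSpace_fin]
  simp only [h.fourierG_neg_neg]

end IsSchwartzBruhat

end TimeMode

section ModePairing

namespace IsAdmissible

variable {V F : Type*} [NormedAddCommGroup V] [NormedAddCommGroup F]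
variable {m : ℕ} {b C : ℝ} {Q : ℤ → V → F}

lemma norm_le_rpow_mul_exp (h : IsAdmissible m b C Q) (k : ℤ) {x : V} (hx : x ≠ 0) :
    ‖Q k x‖ ≤ C * (‖x‖ ^ (-((m : ℝ) + 1)) * Real.exp (-(b * ‖x‖))) := by
  have hb := h.rate_pos
  have hC := h.const_nonneg
  obtain rfl | hk := eq_or_ne k 0
  · rw [h.zero, Pi.zero_apply, norm_zero]
    positivity
  · have hs := one_le_sqrt_abs_intCast hk
    refine (h.norm_le k hk x hx).trans ?_
    rw [Real.rpow_neg (norm_nonneg x), ← Nat.cast_add_one, Real.rpow_natCast, div_eq_mul_inv,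
      mul_assoc]
    gcongr
    exact le_mul_of_one_le_right hb.le hs

variable [NormedSpace ℝ V] [FiniteDimensional ℝ V] [MeasurableSpace V] [BorelSpace V]
  [Nontrivial V] (ν : Measure V) [ν.IsAddHaarMeasure]

lemma aestronglyMeasurable (h : IsAdmissible m b C Q) (k : ℤ) : AEStronglyMeasurable (Q k) ν := by
  rw [← Measure.restrict_eq_self_of_ae_mem (Measure.ae_ne ν (0 : V))]
  exact (h.continuousOn k).aestronglyMeasurable (measurableSet_singleton 0).compl

lemma integrable (h : IsAdmissible m b C Q) (hm : m + 1 < Module.finrank ℝ V) (k : ℤ) :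
    Integrable (Q k) ν := by
  refine ((integrable_norm_rpow_mul_exp ν (s := m + 1) (mod_cast hm) h.rate_pos).const_mul C).mono'
    (h.aestronglyMeasurable ν k) ?_
  filter_upwards [Measure.ae_ne ν (0 : V)] with x hx using h.norm_le_rpow_mul_exp k hx

lemma exists_integral_norm_le (h : IsAdmissible m b C Q) (hm : m + 1 < Module.finrank ℝ V) :
    ∃ J, ∀ k, ∫ x, ‖Q k x‖ ∂ν ≤ J := by
  refine ⟨_, fun k => integral_mono_ae (h.integrable ν hm k).norm
    ((integrable_norm_rpow_mul_exp ν (s := m + 1) (mod_cast hm) h.rate_pos).const_mul C) ?_⟩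
  filter_upwards [Measure.ae_ne ν (0 : V)] with x hx using h.norm_le_rpow_mul_exp k hx

end IsAdmissible

variable {T : ℝ} [Fact (0 < T)] {m : ℕ} {b C : ℝ} {Q : ℤ → E3 → ℂ} {ψ : AddCircle T → E3 → ℂ}

lemma hasSum_mul_fourierCoeff_neg {a : ℤ → ℂ} (ha : Summable fun k => ‖a k‖) {f : AddCircle T → ℂ}
    (hf : Integrable f AddCircle.haarAddCircle) :
    HasSum (fun k => a k * fourierCoeff f (-k))
      (∫ t, (∑' k, fourier k t • a k) * f t ∂AddCircle.haarAddCircle) := by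
  have hint : ∀ k, Integrable (fun t => fourier k t * f t) AddCircle.haarAddCircle := fun k =>
    hf.bdd_mul (c := 1) (map_continuous (fourier k)).aestronglyMeasurable
      (Eventually.of_forall fun t => (norm_fourier_apply k t).le)
  have hnorm : ∀ k, (∫ t, ‖a k * (fourier k t * f t)‖ ∂AddCircle.haarAddCircle) =
      ‖a k‖ * ∫ t, ‖f t‖ ∂AddCircle.haarAddCircle := fun k => by
    simp only [norm_mul, norm_fourier_apply, one_mul, integral_const_mul]
  have hsum := hasSum_integral_of_summable_integral_norm (fun k => (hint k).const_mul (a k))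
    (by simpa only [hnorm] using ha.mul_right _)
  simp only [fourierCoeff, neg_neg, smul_eq_mul, ← tsum_mul_right, ← integral_const_mul]
  simpa only [mul_assoc, mul_left_comm] using hsum

lemma IsAdmissible.integrable_modeSum_mul (h : IsAdmissible m b C Q) (hm : m < 2)
    (hψ : IsSchwartzBruhat T ψ) :
    Integrable (fun z : AddCircle T × E3 => modeSum Q z.1 z.2 * ψ z.1 z.2) (haarG T) := by
  have hb := h.rate_pos
  obtain ⟨B, hB⟩ := hψ.exists_norm_le
  have hmeas : AEStronglyMeasurable (fun z : AddCircle T × E3 => modeSum Q z.1 z.2) (haarG T) := by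
    rw [← Measure.restrict_eq_self_of_ae_mem (μ := haarG T)
      (Measure.quasiMeasurePreserving_snd.ae (Measure.ae_ne volume (0 : E3)))]
    exact h.continuousOn_modeSum.aestronglyMeasurable
      (measurable_snd (measurableSet_singleton 0).compl)
  have htime : Integrable (fun t : AddCircle T => ‖fourier 1 t - 1‖ ^ (-(1 - (1 / 4 : ℝ))))
      AddCircle.haarAddCircle := by
    have hlt := eLpNorm_norm_fourier_one_sub_one_rpow_lt_top (T := T) (s := 1 - 1 / 4) (q := 1)
      (by norm_num) one_pos (by norm_num)
    rw [ENNReal.ofReal_one] at hlt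
    refine memLp_one_iff_integrable.1 ⟨?_, hlt⟩
    exact Measurable.aestronglyMeasurable (by fun_prop)
  have hspace := integrable_norm_rpow_mul_exp (volume : Measure E3) (s := m + 1 + 2 * (1 / 4))
    (c := b / 2) (by
      rw [finrank_euclideanSpace_fin]
      have : (m : ℝ) ≤ 1 := mod_cast Nat.le_of_lt_succ hm
      push_cast
      linarith) (half_pos hb)
  have hmodeSum : Integrable (fun z : AddCircle T × E3 => modeSum Q z.1 z.2) (haarG T) := by
    refine ((htime.mul_prod hspace).const_mul (64 * C / b ^ 2 + (16 / b + 2) * C)).mono' hmeas ?_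
    filter_upwards [Measure.quasiMeasurePreserving_fst.ae ae_fourier_one_ne_one,
      Measure.quasiMeasurePreserving_snd.ae (Measure.ae_ne volume (0 : E3))] with z ht hx
    refine (h.norm_modeSum_le (γ := 1 / 4) (by norm_num) (by norm_num) hx ht).trans_eq ?_
    ring
  exact hmodeSum.mul_bdd (c := B) hψ.continuous.aestronglyMeasurable
    (Eventually.of_forall fun z => hB z.1 z.2)

lemma IsAdmissible.hasSum_integral_mul_timeMode (h : IsAdmissible m b C Q) (hm : m < 2)
    (hψ : IsSchwartzBruhat T ψ) :
    HasSum (fun k => ∫ x, Q k x * timeMode ψ k x)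
      (∫ z, modeSum Q z.1 z.2 * ψ z.1 z.2 ∂haarG T) := by
  obtain ⟨u, hu, hle⟩ := hψ.exists_summable_norm_timeMode_le
  have hm' : m + 1 < Module.finrank ℝ E3 := by
    rw [finrank_euclideanSpace_fin]
    lia
  obtain ⟨J, hJ⟩ := h.exists_integral_norm_le volume hm'
  have hu0 : ∀ k, 0 ≤ u k := fun k => (norm_nonneg _).trans (hle k 0)
  have hint : ∀ k, Integrable fun x => Q k x * timeMode ψ k x := fun k =>
    (h.integrable volume hm' k).mul_bdd (c := u k) (hψ.continuous_timeMode k).aestronglyMeasurable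
      (Eventually.of_forall (hle k))
  have hnorm : ∀ k, ∫ x, ‖Q k x * timeMode ψ k x‖ ≤ J * u k := fun k => by
    refine le_trans ?_ (mul_le_mul_of_nonneg_right (hJ k) (hu0 k))
    rw [← integral_mul_const]
    refine integral_mono (hint k).norm ((h.integrable volume hm' k).norm.mul_const _) fun x => ?_
    rw [norm_mul]
    gcongr
    exact hle k x
  have hsummable : Summable fun k => ∫ x, ‖Q k x * timeMode ψ k x‖ :=
    .of_nonneg_of_le (fun k => integral_nonneg fun x => norm_nonneg _) hnorm (hu.mul_left J)
  convert! hasSum_integral_of_summable_integral_norm hint hsummable using 1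
  rw [haarG, integral_prod_symm _ (h.integrable_modeSum_mul hm hψ)]
  refine integral_congr_ae ?_
  filter_upwards [Measure.ae_ne volume (0 : E3)] with x hx
  have hslice : Continuous fun t => ψ t x := hψ.continuous.comp (Continuous.prodMk_left x)
  exact (hasSum_mul_fourierCoeff_neg (h.summable_norm hx)
    (hslice.integrable_of_hasCompactSupport (.of_compactSpace _))).tsum_eq.symm

end ModePairing

section SoftNorm

variable {V : Type*} [NormedAddCommGroup V]

/-- The smooth regularization `√(‖x‖² + ε²)` of the norm, used to integrate by parts across the
singularity at the origin. -/
def softNorm (ε : ℝ) (x : V) : ℝ := √(‖x‖ ^ 2 + ε ^ 2)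

lemma norm_le_softNorm (ε : ℝ) (x : V) : ‖x‖ ≤ softNorm ε x :=
  Real.le_sqrt_of_sq_le (le_add_of_nonneg_right (sq_nonneg ε))

lemma softNorm_pos {ε : ℝ} (hε : ε ≠ 0) (x : V) : 0 < softNorm ε x :=
  Real.sqrt_pos.2 (by positivity)

lemma continuous_softNorm (ε : ℝ) : Continuous (softNorm ε : V → ℝ) := by
  unfold softNorm
  fun_prop

lemma tendsto_softNorm (x : V) : Tendsto (fun ε => softNorm ε x) (𝓝[≠] 0) (𝓝 ‖x‖) := by
  have h : Continuous fun ε => softNorm ε x := by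
    unfold softNorm
    fun_prop
  simpa [softNorm] using (h.tendsto 0).mono_left nhdsWithin_le_nhds

lemma hasFDerivAt_softNorm [InnerProductSpace ℝ V] {ε : ℝ} (hε : ε ≠ 0) (x : V) :
    HasFDerivAt (softNorm ε) ((softNorm ε x)⁻¹ • innerSL ℝ x) x := by
  refine (((hasStrictFDerivAt_norm_sq x).hasFDerivAt.add_const (ε ^ 2)).sqrt
    (by positivity)).congr_fderiv ?_
  rw [← Nat.cast_smul_eq_nsmul ℝ, smul_smul, softNorm]
  congr 1
  field_simp
  norm_num

variable [MeasurableSpace V] {ν : Measure V} {K : ℝ → V → ℂ}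

/-- A function `K ρ x` of a radius `ρ` and a point `x` which is dominated, uniformly in the radii
`ρ ≥ ‖x‖`, by an integrable function of `x`. -/
structure IsDominatedKernel (ν : Measure V) (K : ℝ → V → ℂ) : Prop where
  measurable : Measurable fun z : ℝ × V => K z.1 z.2
  continuousAt : ∀ x, x ≠ 0 → ContinuousAt (fun ρ => K ρ x) ‖x‖
  exists_bound : ∃ F, Integrable F ν ∧ ∀ x, x ≠ 0 → ∀ ρ, ‖x‖ ≤ ρ → ‖K ρ x‖ ≤ F x

namespace IsDominatedKernel

lemma mul_bounded (h : IsDominatedKernel ν K) {g : V → ℂ} {B : ℝ} (hg : Measurable g)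
    (hB : ∀ x, ‖g x‖ ≤ B) : IsDominatedKernel ν fun ρ x => K ρ x * g x where
  measurable := h.measurable.mul (hg.comp measurable_snd)
  continuousAt x hx := (h.continuousAt x hx).mul continuousAt_const
  exists_bound := by
    obtain ⟨F, hF, hle⟩ := h.exists_bound
    refine ⟨fun x => F x * B, hF.mul_const B, fun x hx ρ hρ => ?_⟩
    rw [norm_mul]
    exact mul_le_mul (hle x hx ρ hρ) (hB x) (norm_nonneg _) ((norm_nonneg _).trans (hle x hx ρ hρ))

variable [BorelSpace V] [NullSingletonClass ν]

lemma integrable_softNorm (h : IsDominatedKernel ν K) (ε : ℝ) :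
    Integrable (fun x => K (softNorm ε x) x) ν := by
  obtain ⟨F, hF, hle⟩ := h.exists_bound
  refine hF.mono' (h.measurable.comp
    ((continuous_softNorm ε).measurable.prodMk measurable_id)).aestronglyMeasurable ?_
  filter_upwards [Measure.ae_ne ν (0 : V)] with x hx using hle x hx _ (norm_le_softNorm ε x)

lemma tendsto_integral_softNorm (h : IsDominatedKernel ν K) :
    Tendsto (fun ε => ∫ x, K (softNorm ε x) x ∂ν) (𝓝[≠] 0) (𝓝 (∫ x, K ‖x‖ x ∂ν)) := by
  obtain ⟨F, hF, hle⟩ := h.exists_bound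
  refine tendsto_integral_filter_of_dominated_convergence F
    (Eventually.of_forall fun ε => (h.integrable_softNorm ε).aestronglyMeasurable)
    (Eventually.of_forall fun ε => ?_) hF ?_
  · filter_upwards [Measure.ae_ne ν (0 : V)] with x hx using hle x hx _ (norm_le_softNorm ε x)
  · filter_upwards [Measure.ae_ne ν (0 : V)] with x hx
    exact (h.continuousAt x hx).tendsto.comp (tendsto_softNorm x)

end IsDominatedKernel

end SoftNorm

section YukawaParts

variable {V : Type*} [NormedAddCommGroup V] [InnerProductSpace ℝ V] [FiniteDimensional ℝ V]
  [MeasurableSpace V] [BorelSpace V] (ν : Measure V) [ν.IsAddHaarMeasure]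
variable {μ : ℂ} {v : V}

lemma isDominatedKernel_yukawa (hμ : ‖v‖ < μ.re) (hV : 1 < Module.finrank ℝ V) :
    IsDominatedKernel ν (yukawa μ v) where
  measurable := by
    unfold yukawa
    fun_prop
  continuousAt x hx := by
    unfold yukawa
    have : ((4 * Real.pi * ‖x‖ : ℝ) : ℂ) ≠ 0 := by simpa using hx
    fun_prop (disch := assumption)
  exists_bound := by
    have := Module.nontrivial_of_finrank_pos (zero_lt_one.trans hV)
    refine ⟨_, integrable_norm_rpow_mul_exp ν (s := 1) (mod_cast hV) (sub_pos.2 hμ),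
      fun x hx ρ hρ => (norm_yukawa_le μ v hρ).trans ?_⟩
    have hr : 0 < ‖x‖ := norm_pos_iff.2 hx
    have hc : 0 < μ.re - ‖v‖ := sub_pos.2 hμ
    rw [Real.rpow_neg_one]
    gcongr

lemma isDominatedKernel_yukawaDeriv_apply (hμ : ‖v‖ < μ.re) (hV : 2 < Module.finrank ℝ V) (w : V) :
    IsDominatedKernel ν fun ρ x => yukawaDeriv μ v ρ x w where
  measurable := by
    simp only [yukawaDeriv, yukawa, smul_apply, add_apply, innerForm_apply]
    fun_prop
  continuousAt x hx := by
    simp only [yukawaDeriv, yukawa, smul_apply, add_apply, innerForm_apply]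
    have h1 : ((4 * Real.pi * ‖x‖ : ℝ) : ℂ) ≠ 0 := by simpa using hx
    have h2 : (‖x‖ : ℂ) ≠ 0 := by simpa using hx
    fun_prop (disch := assumption)
  exists_bound := by
    have := Module.nontrivial_of_finrank_pos (zero_lt_two.trans hV)
    have hfirst := (integrable_norm_rpow_mul_exp ν (s := 1) (by norm_cast; lia)
      (sub_pos.2 hμ)).const_mul (‖v‖ + ‖μ‖)
    have hsecond := integrable_norm_rpow_mul_exp ν (s := 2) (by norm_cast) (sub_pos.2 hμ)
    refine ⟨_, (hfirst.add hsecond).mul_const ‖w‖, fun x hx ρ hρ => ?_⟩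
    have hr : 0 < ‖x‖ := norm_pos_iff.2 hx
    have hρ0 : 0 < ρ := hr.trans_le hρ
    have hc : 0 < μ.re - ‖v‖ := sub_pos.2 hμ
    have hle : ‖yukawaDeriv μ v ρ x‖ ≤
        ‖x‖⁻¹ * Real.exp (-((μ.re - ‖v‖) * ‖x‖)) * (‖v‖ + ‖μ‖ + ‖x‖⁻¹) := by
      refine (norm_yukawaDeriv_le μ v hρ).trans ?_
      gcongr
    refine ((yukawaDeriv μ v ρ x).le_of_opNorm_le hle w).trans_eq ?_
    simp only [Pi.add_apply, Real.rpow_neg_one, Real.rpow_neg hr.le, Real.rpow_two]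
    ring

lemma integral_yukawa_mul_lineDeriv (hμ : ‖v‖ < μ.re) (hV : 2 < Module.finrank ℝ V) {w : V}
    {g g' : V → ℂ} {B B' : ℝ} (hg : Measurable g) (hg' : Measurable g') (hB : ∀ x, ‖g x‖ ≤ B)
    (hB' : ∀ x, ‖g' x‖ ≤ B') (hderiv : ∀ x, HasLineDerivAt ℝ g (g' x) x w) :
    ∫ x, yukawa μ v ‖x‖ x * g' x ∂ν = -∫ x, yukawaDeriv μ v ‖x‖ x w * g x ∂ν := by
  have := Module.nontrivial_of_finrank_pos (zero_lt_two.trans hV)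
  have hyukawa := isDominatedKernel_yukawa ν hμ (one_lt_two.trans hV)
  have hleft := hyukawa.mul_bounded hg' hB'
  have hright := (isDominatedKernel_yukawaDeriv_apply ν hμ hV w).mul_bounded hg hB
  refine tendsto_nhds_unique hleft.tendsto_integral_softNorm
    (hright.tendsto_integral_softNorm.neg.congr' ?_)
  filter_upwards [self_mem_nhdsWithin] with ε hε
  exact (integral_bilinear_hasLineDerivAt_right_eq_neg_left_of_integrable
    (B := ContinuousLinearMap.mul ℝ ℂ) (hright.integrable_softNorm ε) (hleft.integrable_softNorm ε)
    ((hyukawa.mul_bounded hg hB).integrable_softNorm ε)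
    (fun x _ => (hasFDerivAt_yukawa μ v (hasFDerivAt_softNorm hε x)
      (softNorm_pos hε x).ne').hasLineDerivAt w) fun x _ => hderiv x).symm

end YukawaParts

section TimeModeDeriv

variable {T : ℝ} {ψ : AddCircle T → E3 → ℂ}

lemma IsSchwartzBruhat.hasDerivAt_line (h : IsSchwartzBruhat T ψ) (j : Fin 3) (t : AddCircle T)
    (x : E3) (r : ℝ) :
    HasDerivAt (fun r : ℝ => ψ t (x + r • EuclideanSpace.single j 1))
      (TimePeriodic.pdx j ψ t (x + r • EuclideanSpace.single j 1)) r := by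
  have hψ : HasFDerivAt (ψ t) _ (x + r • EuclideanSpace.single j 1) :=
    ((h.contDiff_space t).differentiable (by simp) _).hasFDerivAt
  have hline : HasDerivAt (fun r : ℝ => x + r • (EuclideanSpace.single j 1 : E3))
      ((1 : ℝ) • EuclideanSpace.single j 1) r :=
    ((hasDerivAt_id r).smul_const _).const_add x
  simpa only [one_smul] using! hψ.comp_hasDerivAt r hline

lemma IsSchwartzBruhat.hasLineDerivAt_timeMode [Fact (0 < T)] (h : IsSchwartzBruhat T ψ) (k : ℤ)
    (j : Fin 3) (x : E3) :
    HasLineDerivAt ℝ (timeMode ψ k) (timeMode (TimePeriodic.pdx j ψ) k x) x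
      (EuclideanSpace.single j 1) := by
  obtain ⟨B, hB⟩ := (h.pdx j).exists_norm_le
  have hcont : ∀ {f : AddCircle T → E3 → ℂ}, IsSchwartzBruhat T f → ∀ y,
      Continuous fun t => fourier k t * f t y := fun hf y =>
    (map_continuous (fourier k)).mul (hf.continuous.comp (.prodMk_left y))
  have hbound : ∀ t y, ‖fourier k t * TimePeriodic.pdx j ψ t y‖ ≤ B := fun t y =>
    (norm_fourier_smul k t _).trans_le (hB t y)
  have hderiv := (hasDerivAt_integral_of_dominated_loc_of_deriv_le
    (μ := AddCircle.haarAddCircle) (bound := fun _ => B) (x₀ := (0 : ℝ)) univ_mem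
    (Eventually.of_forall fun r =>
      (hcont h (x + r • EuclideanSpace.single j 1)).aestronglyMeasurable)
    ((hcont h (x + (0 : ℝ) • EuclideanSpace.single j 1)).integrable_of_hasCompactSupport
      (.of_compactSpace _))
    (hcont (h.pdx j) (x + (0 : ℝ) • EuclideanSpace.single j 1)).aestronglyMeasurable
    (Eventually.of_forall fun t r _ => hbound t (x + r • EuclideanSpace.single j 1))
    (integrable_const B)
    (Eventually.of_forall fun t r _ => (h.hasDerivAt_line j t x r).const_mul (fourier k t))).2
  simp only [HasLineDerivAt, timeMode_eq_integral]
  simpa only [zero_smul, add_zero] using hderiv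

end TimeModeDeriv

section PhiPerp

lemma abs_lt_mass_re (a : ℝ) {s : ℝ} (hs : s ≠ 0) : |a| < (mass a s).re := by
  refine sub_pos.1 (pos_of_mul_pos_right ?_ (by positivity : 0 ≤ 8 * ‖mass a s‖ ^ 3))
  exact (pow_pos (abs_pos.2 hs) 2).trans_le ((sq_abs s).trans_le (sq_le_mul_mass_re_sub a s))

/-- Half the drift `λ e₁`. Conjugating `-Δ - λ ∂₁ + iω` with `e^{-⟪v, x⟫}`, where `v` is this
vector, turns it into the operator `-Δ + ‖v‖² + iω` without drift. -/
def halfDrift (lam : ℝ) : E3 := (lam / 2) • EuclideanSpace.single 0 1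

lemma inner_halfDrift (lam : ℝ) (ξ : E3) : ⟪halfDrift lam, ξ⟫ = lam / 2 * ξ 0 := by
  simp [halfDrift, real_inner_smul_left, EuclideanSpace.inner_single_left]

/-- The `k`-th Fourier coefficient in time of `φ_⊥`. -/
def phiMode (lam T : ℝ) : ℤ → E3 → ℂ :=
  massFamily ‖halfDrift lam‖ (2 * Real.pi / T) fun μ x => yukawa μ (halfDrift lam) ‖x‖ x

/-- The derivative of `phiMode` in space. -/
def phiModeDeriv (lam T : ℝ) : ℤ → E3 → E3 →L[ℝ] ℂ :=
  massFamily ‖halfDrift lam‖ (2 * Real.pi / T) fun μ x => yukawaDeriv μ (halfDrift lam) ‖x‖ x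

variable {lam T : ℝ}

lemma hasFDerivAt_phiMode (k : ℤ) {x : E3} (hx : x ≠ 0) :
    HasFDerivAt (phiMode lam T k) (phiModeDeriv lam T k x) x := by
  obtain rfl | hk := eq_or_ne k 0
  · exact hasFDerivAt_const 0 x
  · rw [phiMode, phiModeDeriv, massFamily_of_ne_zero _ _ _ hk, massFamily_of_ne_zero _ _ _ hk]
    exact hasFDerivAt_yukawa_norm _ _ hx

variable [hT : Fact (0 < T)]

lemma norm_halfDrift_lt_mass_re (lam : ℝ) {k : ℤ} (hk : k ≠ 0) :
    ‖halfDrift lam‖ < (mass ‖halfDrift lam‖ (2 * Real.pi / T * k)).re := by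
  have hT0 := hT.out
  have := abs_lt_mass_re ‖halfDrift lam‖ (s := 2 * Real.pi / T * k)
    (mul_ne_zero (by positivity) (Int.cast_ne_zero.2 hk))
  rwa [abs_norm] at this

lemma integral_phiMode_mul_cexp (k : ℤ) (ξ : E3) :
    ∫ x, phiMode lam T k x * cexp (-(I * (⟪x, ξ⟫ : ℝ))) = symbolPerp lam T k ξ := by
  obtain rfl | hk := eq_or_ne k 0
  · simp [phiMode, massFamily, symbolPerp]
  · have h := integral_yukawa_mul_cexp (norm_halfDrift_lt_mass_re (T := T) lam hk) ξ
    rw [mass_sq, inner_halfDrift] at h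
    rw [phiMode, massFamily_of_ne_zero _ _ _ hk, symbolPerp, if_neg hk, sub_zero, one_div]
    refine (eq_inv_of_mul_eq_one_left h).trans (congrArg _ ?_)
    push_cast
    ring

variable (lam T) in
lemma exists_isAdmissible_phiMode : ∃ b C, IsAdmissible 0 b C (phiMode lam T) :=
  have hT0 := hT.out
  exists_isAdmissible_yukawa (halfDrift lam) (by positivity)

variable (lam T) in
lemma exists_isAdmissible_phiModeDeriv : ∃ b C, IsAdmissible 1 b C (phiModeDeriv lam T) :=
  have hT0 := hT.out
  exists_isAdmissible_yukawaDeriv (halfDrift lam) (by positivity)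

variable {ψ : AddCircle T → E3 → ℂ}

lemma phiPerpDist_eq_tsum (hψ : IsSchwartzBruhat T ψ) :
    phiPerpDist lam T ψ = ∑' k, ∫ x, phiMode lam T k x * timeMode ψ k x := by
  obtain ⟨b, C, h⟩ := exists_isAdmissible_phiMode lam T
  refine tsum_congr fun k => ?_
  simp only [← integral_phiMode_mul_cexp]
  exact hψ.inv_mul_integral_mul_fourierG k (h.integrable volume (by simp) k)

lemma integral_phiMode_mul_timeMode_pdx (hψ : IsSchwartzBruhat T ψ) (j : Fin 3) (k : ℤ) :
    ∫ x, phiMode lam T k x * timeMode (pdx j ψ) k x =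
      -∫ x, phiModeDeriv lam T k x (EuclideanSpace.single j 1) * timeMode ψ k x := by
  obtain rfl | hk := eq_or_ne k 0
  · simp [phiMode, phiModeDeriv, massFamily]
  · obtain ⟨u, -, hu⟩ := hψ.exists_summable_norm_timeMode_le
    obtain ⟨u', -, hu'⟩ := (hψ.pdx j).exists_summable_norm_timeMode_le
    rw [phiMode, phiModeDeriv, massFamily_of_ne_zero _ _ _ hk, massFamily_of_ne_zero _ _ _ hk]
    exact integral_yukawa_mul_lineDeriv volume (norm_halfDrift_lt_mass_re lam hk) (by simp)
      (hψ.continuous_timeMode k).measurable ((hψ.pdx j).continuous_timeMode k).measurable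
      (hu k) (hu' k) (hψ.hasLineDerivAt_timeMode k j)

/-- The function on `𝕋 × ℝ³` representing `φ_⊥`. -/
def phiPerp (lam T : ℝ) : AddCircle T → E3 → ℂ := modeSum (phiMode lam T)

lemma hasFDerivAt_phiPerp (t : AddCircle T) {x : E3} (hx : x ≠ 0) :
    HasFDerivAt (phiPerp lam T t) (modeSum (phiModeDeriv lam T) t x) x := by
  obtain ⟨b, C, h⟩ := exists_isAdmissible_phiMode lam T
  obtain ⟨b', C', h'⟩ := exists_isAdmissible_phiModeDeriv lam T
  exact h.hasFDerivAt_modeSum h' (fun k x hx => hasFDerivAt_phiMode k hx) t hx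

lemma pdx_phiPerp (j : Fin 3) (t : AddCircle T) {x : E3} (hx : x ≠ 0) :
    pdx j (phiPerp lam T) t x =
      modeSum (fun k x => phiModeDeriv lam T k x (EuclideanSpace.single j 1)) t x := by
  obtain ⟨b, C, h⟩ := exists_isAdmissible_phiModeDeriv lam T
  rw [pdx, (hasFDerivAt_phiPerp t hx).fderiv]
  exact (ContinuousLinearMap.apply ℝ ℂ (EuclideanSpace.single j 1)).map_tsum
    (summable_fourier_smul (h.summable_norm hx) t)

variable (lam T)

lemma isRegularDist_phiPerp : IsRegularDist T (phiPerpDist lam T) (phiPerp lam T) := by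
  intro ψ hψ
  obtain ⟨b, C, h⟩ := exists_isAdmissible_phiMode lam T
  refine ⟨h.integrable_modeSum_mul two_pos hψ, ?_⟩
  rw [phiPerpDist_eq_tsum hψ]
  exact (h.hasSum_integral_mul_timeMode two_pos hψ).tsum_eq

lemma isRegularDist_pdx_phiPerp (j : Fin 3) :
    IsRegularDist T (distPdx j (phiPerpDist lam T)) (pdx j (phiPerp lam T)) := by
  intro ψ hψ
  obtain ⟨b, C, h⟩ := exists_isAdmissible_phiModeDeriv lam T
  have hj := h.continuousLinearMap_apply (v := EuclideanSpace.single j 1) (by simp)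
  have hae : (fun z : AddCircle T × E3 => pdx j (phiPerp lam T) z.1 z.2 * ψ z.1 z.2) =ᵐ[haarG T]
      fun z => modeSum (fun k x => phiModeDeriv lam T k x (EuclideanSpace.single j 1)) z.1 z.2 *
        ψ z.1 z.2 := by
    filter_upwards [Measure.quasiMeasurePreserving_snd.ae (Measure.ae_ne volume (0 : E3))] with z hz
    rw [pdx_phiPerp j z.1 hz]
  refine ⟨(integrable_congr hae).2 (hj.integrable_modeSum_mul one_lt_two hψ), ?_⟩
  rw [integral_congr_ae hae, ← (hj.hasSum_integral_mul_timeMode one_lt_two hψ).tsum_eq, distPdx,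
    phiPerpDist_eq_tsum (hψ.pdx j), ← tsum_neg]
  exact tsum_congr fun k => by rw [integral_phiMode_mul_timeMode_pdx hψ, neg_neg]

lemma continuousOn_gradx_phiPerp :
    ContinuousOn (fun z : AddCircle T × E3 => gradx (phiPerp lam T) z.1 z.2) {z | z.2 ≠ 0} := by
  obtain ⟨b, C, h⟩ := exists_isAdmissible_phiModeDeriv lam T
  refine (PiLp.continuous_toLp 2 _).comp_continuousOn (continuousOn_pi.2 fun j => ?_)
  exact (h.continuousLinearMap_apply (by simp)).continuousOn_modeSum.congr fun z hz =>
    pdx_phiPerp j z.1 hz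

theorem isPhiPerp_phiPerp : IsPhiPerp lam T (phiPerp lam T) where
  regular := isRegularDist_phiPerp lam T
  regular_grad := isRegularDist_pdx_phiPerp lam T
  continuousOn :=
    have ⟨_, _, h⟩ := exists_isAdmissible_phiMode lam T
    h.continuousOn_modeSum
  differentiableAt t _ hx := (hasFDerivAt_phiPerp t hx).differentiableAt
  continuousOn_grad := continuousOn_gradx_phiPerp lam T

lemma eLpNorm_gradx_phiPerp_le {x : E3} (hx : x ≠ 0) (p : ℝ≥0∞) :
    eLpNorm (fun t => gradx (phiPerp lam T) t x) p AddCircle.haarAddCircle ≤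
      ENNReal.ofReal 3 *
        eLpNorm (fun t : AddCircle T => modeSum (phiModeDeriv lam T) t x) p
          AddCircle.haarAddCircle :=
  eLpNorm_le_mul_eLpNorm_of_ae_le_mul (Eventually.of_forall fun t =>
    (norm_gradx_le (phiPerp lam T) t x).trans_eq (by rw [(hasFDerivAt_phiPerp t hx).fderiv])) p

end PhiPerp

end TimePeriodic

end

theorem theorem4p4_general (lam T : ℝ) [Fact (0 < T)] :
    ∃ φ : AddCircle T → TimePeriodic.E3 → ℂ, TimePeriodic.IsPhiPerp lam T φ ∧
      ∃ C₃ : ℝ, 0 < C₃ ∧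
        ∀ γ : ℝ, 0 ≤ γ → γ < 1 → ∀ q : ℝ, 0 < q → q < 1 / (1 - γ) →
          ∃ C : ℝ, 0 < C ∧ ∀ x : TimePeriodic.E3, x ≠ 0 →
            eLpNorm (fun t => φ t x) (ENNReal.ofReal q) AddCircle.haarAddCircle ≤
                ENNReal.ofReal (C * ‖x‖ ^ (-(1 + 2 * γ)) * Real.exp (-(C₃ * ‖x‖))) ∧
            eLpNorm (fun t => TimePeriodic.gradx φ t x) (ENNReal.ofReal q)
                AddCircle.haarAddCircle ≤
                ENNReal.ofReal (C * ‖x‖ ^ (-(2 + 2 * γ)) * Real.exp (-(C₃ * ‖x‖))) := by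
  obtain ⟨b, _, h⟩ := TimePeriodic.exists_isAdmissible_phiMode lam T
  obtain ⟨b', _, h'⟩ := TimePeriodic.exists_isAdmissible_phiModeDeriv lam T
  refine ⟨_, TimePeriodic.isPhiPerp_phiPerp lam T, min b b' / 2,
    half_pos (lt_min h.rate_pos h'.rate_pos), fun γ hγ0 hγ1 q hq0 hq => ?_⟩
  obtain ⟨K, hK, hle⟩ := h.exists_eLpNorm_modeSum_le (T := T) hγ0 hγ1 hq0 hq
  obtain ⟨K', -, hle'⟩ := h'.exists_eLpNorm_modeSum_le (T := T) hγ0 hγ1 hq0 hq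
  refine ⟨max K (3 * K'), lt_max_of_lt_left hK, fun x hx => ⟨?_, ?_⟩⟩
  · refine (hle x hx).trans ?_
    rw [Nat.cast_zero, zero_add]
    gcongr
    exacts [le_max_left _ _, min_le_left _ _]
  · refine (TimePeriodic.eLpNorm_gradx_phiPerp_le lam T hx _).trans ?_
    refine (mul_le_mul_right (hle' x hx) _).trans ?_
    rw [← ENNReal.ofReal_mul zero_le_three, Nat.cast_one, one_add_one_eq_two, ← mul_assoc,
      ← mul_assoc]
    gcongr
    exacts [le_max_right _ _, min_le_right _ _]

theorem theorem4p4 (lam T : ℝ) (hlam : 0 < lam) [Fact (0 < T)] :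
    ∃ φ : AddCircle T → TimePeriodic.E3 → ℂ, TimePeriodic.IsPhiPerp lam T φ ∧
      ∃ C₃ : ℝ, 0 < C₃ ∧
        ∀ γ : ℝ, 0 < γ → γ < 1 → ∀ q : ℝ, 1 ≤ q → q < 1 / (1 - γ) →
          ∃ C : ℝ, 0 < C ∧ ∀ x : TimePeriodic.E3, x ≠ 0 →
            eLpNorm (fun t => φ t x) (ENNReal.ofReal q) AddCircle.haarAddCircle ≤
                ENNReal.ofReal (C * ‖x‖ ^ (-(1 + 2 * γ)) * Real.exp (-(C₃ * ‖x‖))) ∧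
            eLpNorm (fun t => TimePeriodic.gradx φ t x) (ENNReal.ofReal q)
                AddCircle.haarAddCircle ≤
                ENNReal.ofReal (C * ‖x‖ ^ (-(2 + 2 * γ)) * Real.exp (-(C₃ * ‖x‖))) := by
  obtain ⟨φ, hφ, C₃, hC₃, h⟩ := theorem4p4_general lam T
  exact ⟨φ, hφ, C₃, hC₃, fun γ hγ0 hγ1 q hq => h γ hγ0.le hγ1 q (one_pos.trans_le hq)⟩
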